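/- Let $n\ge 2$, $I=\{0,1,\dots,n\}$, $I'=\{1,\dots,n\}$, $\mathbb N=\{0,1,2,\dots\}$. **Roots.** Let $C=(c_{ij})\in\mathbb Z^{I\times I}$ be the Cartan matrix of type $\widetilde{\mathsf C}_n$: $c_{ii}=2$, $c_{10}=c_{n-1,n}=-2$, all other $c_{ij}$ with $|i-j|=1$ are $-1$, and $c_{ij}=0$ for $|i-j|>1$. Let $D=\operatorname{diag}(2,1,\dots,1,2)$, let $\alpha_i$ be the standard basis of $\mathbb Z^I$, and $s_i(\alpha_j)=\alpha_j-c_{ij}\alpha_i$. The real roots are the images of the $\alpha_i$ under the group generated by the $s_i$; $\Delta^+_{\rm re}$ is the set of real roots in $\mathbb N^I$. A real root $\alpha$ is *long* if $\alpha^{t}DC\alpha$ is maximal among the real roots. Put $\rho=(1,2,\dots,2,1)$. **Orientation and defect.** For each $k\in I'$ choose an arrow $\eta_k$ between $k-1$ and $k$, in either direction; put $\omega(k)=1$ if it points from $k$ to $k-1$, and $\omega(k)=-1$ otherwise. Let $Q$ be the quiver with vertex set $I$, the arrows $\eta_1,\dots,\eta_n$, and loops $\varepsilon_0$ at $0$ and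 $\varepsilon_n$ at $n$. Let $\langle-,-\rangle$ be the bilinear form on $\mathbb Z^I$ with $\langle\alpha_i,\alpha_i\rangle=2$ if $i\in\{0,n\}$ and $=1$ otherwise, and, for $i\ne j$, $\langle\alpha_i,\alpha_j\rangle=0$ unless some $\eta_k$ goes from $i$ to $j$, in which case it is $-2$ if $\{i,j\}\cap\{0,n\}\neq\emptyset$ and $-1$ otherwise. The defect is $d(\alpha)=\langle\alpha,\rho\rangle$. **Strings.** Letters are the arrows and their formal inverses, where $s(a^{-1})=t(a)$ and $t(a^{-1})=s(a)$. Strings are the words $w_1\cdots w_l$ ($l\ge1$) in the letters with $s(w_{j-1})=t(w_j)$ and $w_{j-1}\ne w_j^{\pm1}$, together with trivial words $\mathbb 1_i\neq\mathbb 1_i^{-1}$ for $i\in I$. Inverses are $(w_1\cdots w_l)^{-1}=w_l^{-1}\cdots w_1^{-1}$. The product $\mathbf v\mathbf w$ of two strings is their concatenation, defined when it is a string; a trivial word is neutral in a product, and the products of trivial words with letters are defined exactly in the cases $\mathbb 1_{k-1}\eta_k^{\omega(k)}$, $\eta_k^{\omega(k)}\mathbb 1_k$, $\varepsilon_0^{\pm1}\mathbb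 1_0$, $\mathbb 1_n\varepsilon_n^{\pm1}$ and the inverses of these (and similarly for longer words, according to the adjacent letter); $\mathbb 1_i^{\pm1}\mathbb 1_i^{\pm1}=\mathbb 1_i^{\pm1}$. A string is direct (inverse) if it has no inverse (no direct) letters; trivial words are both. A string $\mathbf w=w_1\cdots w_l$ is *locally free* if $s(w_l)\in\{0,n\}$ implies $w_l=\varepsilon_{s(w_l)}^{\pm1}$ and $t(w_1)\in\{0,n\}$ implies $w_1=\varepsilon_{t(w_1)}^{\pm1}$; $\mathbb 1_i^{\pm1}$ is locally free iff $1\le i\le n-1$. Let $\mathrm{St}_{\rm lf}$ be the set of locally free strings. The rank vector $\mathrm{rk}(\mathbf w)\in\mathbb N^I$ has as $i$-th entry the number of occurrences of $i$ in the sequence $t(w_1),\dots,t(w_l),s(w_l)$ (in the one-term sequence $j$ if $\mathbf w=\mathbb 1_j^{\pm1}$), divided by $2$ if $i\in\{0,n\}$. Two strings are *similar* if they become equal when the exponents $\pm1$ of all letters $\varepsilon_0^{\pm1},\varepsilon_n^{\pm1}$ are forgotten; $[\mathbf w]$ is the similarity class of $\mathbf w$ in the set of all strings. **$\tau$-locally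 free strings.** For $i\in I$ let $\mathbf p_i=\mathbf p'\mathbf p''$, where $\mathbf p'$ is the longest direct string for which $\mathbf p'\mathbb 1_i$ is defined and $\mathbf p''$ is the longest inverse string for which $\mathbb 1_i\mathbf p''$ is defined. Let $\mathbf q_i=\mathbf q'\mathbf q''$, where $\mathbf q'$ is the longest inverse string for which $\mathbf q'\mathbb 1_i$ is defined and $\mathbf q''$ is the longest direct string for which $\mathbb 1_i\mathbf q''$ is defined. For $i\in I'$ let $\mathbf r_i$ be the longest inverse string for which $\eta_i\mathbf r_i$ is defined, and $\mathbf r_i'$ the longest direct string for which $\eta_i^{-1}\mathbf r'_i$ is defined. For each $\mathbf w\in\mathrm{St}_{\rm lf}$ exactly one of the products $\mathbf w\eta_j^{\pm1}$ $(j\in I')$ is defined; put $\mathbf w[1]=\mathbf w\eta_j\mathbf r_j$ if it is $\mathbf w\eta_j$, and $\mathbf w[-1]=\mathbf w\eta_j^{-1}\mathbf r'_j$ if it is $\mathbf w\eta_j^{-1}$. When defined, let $[\pm1]\mathbf w=(\mathbf w^{-1}[\pm1])^{-1}$, and let $\mathbf w[\pm k]$, $[\pm k]\mathbf w$ be the $k$-fold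 iterates, $k\in\mathbb N$. The set $\mathrm{St}^\tau_{\rm lf}\subseteq \mathrm{St}_{\rm lf}$ of $\tau$-locally free strings consists of the strings $([k]\mathbf p_i[k])^{\pm1}$ and $([-k]\mathbf q_i[-k])^{\pm1}$ with $(i,k)\in I\times\mathbb N$ and $(\mathbf r_i[k])^{\pm1}$ with $(i,k)\in I'\times\mathbb N$. **Claim.** (1) For each $\mathbf w\in\mathrm{St}_{\rm lf}$ there is a $\mathbf w_\tau\in\mathrm{St}_{\rm lf}^\tau$ such that $$[\mathbf w]\cap\mathrm{St}^\tau_{\rm lf}=\begin{cases}\{\mathbf w_\tau,\mathbf w_\tau^{-1}\}&\text{if }\mathrm{rk}(\mathbf w)\in\Delta^+_{\rm re}\text{ is a long root},\\ \{\mathbf w_\tau\}&\text{else.}\end{cases}$$ (2) For each $\alpha\in\Delta_{\rm re}^+$ the set $\mathrm{rk}^{-1}(\alpha)=\{\mathbf w\in\mathrm{St}_{\rm lf}\mid\mathrm{rk}(\mathbf w)=\alpha\}$ equals $$\mathrm{rk}^{-1}(\alpha)=\begin{cases} [\,[k]\mathbf p_i[k]\,]\cup[([k]\mathbf p_i[k])^{-1}]&\text{for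 a unique }(i,k)\in I\times\mathbb N,\text{ if }d(\alpha)>0,\\ [\mathbf r_i[k]]\cup[(\mathbf r_i[k])^{-1}]&\text{for a unique }(i,k)\in I'\times\mathbb N,\text{ if }d(\alpha)=0,\\ [\,[-k]\mathbf q_i[-k]\,]\cup[([-k]\mathbf q_i[-k])^{-1}]&\text{for a unique }(i,k)\in I\times\mathbb N,\text{ if }d(\alpha)<0.\end{cases}$$ (3) In the situation of (2), if $d(\alpha)>0$ then $[\,[k]\mathbf p_i[k]\,]=[([k]\mathbf p_i[k])^{-1}]$ if and only if $\alpha$ is a long root, and if $d(\alpha)<0$ then $[\,[-k]\mathbf q_i[-k]\,]=[([-k]\mathbf q_i[-k])^{-1}]$ if and only if $\alpha$ is a long root. -/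

import Mathlib

namespace CTilde

/-! ### The Cartan matrix of type `C̃ₙ`, real roots, lengths

The vertex set is `I = {0, …, n}`, the root lattice is `ℤ^I`. All definitions are meant for
`2 ≤ n`. -/

/-- The vertices `0` and `n`, which carry the loops. -/
def IsEnd {n : ℕ} (i : Fin (n + 1)) : Prop := i = 0 ∨ i = Fin.last n

instance {n : ℕ} (i : Fin (n + 1)) : Decidable (IsEnd i) :=
  inferInstanceAs (Decidable (i = 0 ∨ i = Fin.last n))

/-- The generalized Cartan matrix of type `C̃ₙ`: `c₁₀ = cₙ₋₁,ₙ = -2`, the other entries next to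
the diagonal are `-1`. -/
def cartan (n : ℕ) : Matrix (Fin (n + 1)) (Fin (n + 1)) ℤ := fun i j =>
  if i = j then 2
  else if i.val + 1 = j.val ∨ j.val + 1 = i.val then (if IsEnd j then -2 else -1)
  else 0

/-- The diagonal of the minimal symmetrizer `D = diag(2, 1, …, 1, 2)`. -/
def symmetrizer (n : ℕ) (i : Fin (n + 1)) : ℤ := if IsEnd i then 2 else 1

/-- The simple root `αᵢ`. -/
def simpleRoot {n : ℕ} (i : Fin (n + 1)) : Fin (n + 1) → ℤ := Pi.single i 1

/-- The simple reflection `sᵢ(α) = α - ⟨αᵢ^∨, α⟩ αᵢ`, where `⟨αᵢ^∨, αⱼ⟩ = cᵢⱼ`. -/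
def reflect {n : ℕ} (i : Fin (n + 1)) (α : Fin (n + 1) → ℤ) : Fin (n + 1) → ℤ :=
  α - (∑ j, cartan n i j * α j) • simpleRoot i

/-- Real roots: the orbit of the simple roots under the Weyl group, which is generated by the
simple reflections. -/
inductive IsRealRoot {n : ℕ} : (Fin (n + 1) → ℤ) → Prop
  | simple (i : Fin (n + 1)) : IsRealRoot (simpleRoot i)
  | reflect (i : Fin (n + 1)) {α : Fin (n + 1) → ℤ} : IsRealRoot α → IsRealRoot (reflect i α)

/-- The set of positive real roots. -/
def posRealRoots (n : ℕ) : Set (Fin (n + 1) → ℤ) := {α | IsRealRoot α ∧ ∀ i, 0 ≤ α i}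

/-- The squared length `(α, α)` for the Weyl group invariant symmetric bilinear form with Gram
matrix `D C`. -/
def sqLength {n : ℕ} (α : Fin (n + 1) → ℤ) : ℤ :=
  ∑ i, ∑ j, α i * (symmetrizer n i * cartan n i j) * α j

/-- A real root is long if its squared length is maximal among all real roots. -/
def IsLongRoot {n : ℕ} (α : Fin (n + 1) → ℤ) : Prop :=
  IsRealRoot α ∧ ∀ β : Fin (n + 1) → ℤ, IsRealRoot β → sqLength β ≤ sqLength α

/-! ### The quiver

An orientation is given by `ω : Fin n → Bool`. The index `k : Fin n` stands for the arrow
`η_{k+1}`, which joins the vertices `k` and `k + 1`; it points to the left (from `k + 1` to `k`)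
if `ω k = true`, and to the right if `ω k = false`. -/

/-- The arrows: the loop `ε₀` at `0`, the loop `εₙ` at `n`, and `η₁, …, ηₙ`. -/
inductive Arrow (n : ℕ)
  | eps0 : Arrow n
  | epsN : Arrow n
  | eta (k : Fin n) : Arrow n
deriving DecidableEq

/-- The starting point of an arrow. -/
def Arrow.s {n : ℕ} (ω : Fin n → Bool) : Arrow n → Fin (n + 1)
  | .eps0 => 0
  | .epsN => Fin.last n
  | .eta k => if ω k then k.succ else k.castSucc

/-- The terminal point of an arrow. -/
def Arrow.t {n : ℕ} (ω : Fin n → Bool) : Arrow n → Fin (n + 1)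
  | .eps0 => 0
  | .epsN => Fin.last n
  | .eta k => if ω k then k.castSucc else k.succ

/-- The bilinear form of the orientation on simple roots. A pair `(j, i)` belongs to the
orientation `Ω` iff there is an arrow `η_k` from `i` to `j`. -/
def formMatrix {n : ℕ} (ω : Fin n → Bool) : Matrix (Fin (n + 1)) (Fin (n + 1)) ℤ := fun i j =>
  if i = j then (if IsEnd i then 2 else 1)
  else if ∃ k : Fin n, j = (Arrow.eta k).t ω ∧ i = (Arrow.eta k).s ω then
    (if IsEnd i ∨ IsEnd j then -2 else -1)
  else 0

/-- The minimal positive isotropic root `ρ = (1, 2, …, 2, 1)`. -/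
def rho (n : ℕ) (i : Fin (n + 1)) : ℤ := if IsEnd i then 1 else 2

/-- The defect `⟨α, ρ⟩`. -/
def defect {n : ℕ} (ω : Fin n → Bool) (α : Fin (n + 1) → ℤ) : ℤ :=
  ∑ i, ∑ j, α i * formMatrix ω i j * rho n j

/-! ### Letters, words, strings -/

/-- A letter is an arrow (`direct = true`) or the formal inverse of an arrow
(`direct = false`). -/
structure Letter (n : ℕ) where
  arrow : Arrow n
  direct : Bool
deriving DecidableEq

/-- The inverse of a letter. -/
def Letter.inv {n : ℕ} (a : Letter n) : Letter n := ⟨a.arrow, !a.direct⟩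

def Letter.s {n : ℕ} (ω : Fin n → Bool) (a : Letter n) : Fin (n + 1) :=
  if a.direct then a.arrow.s ω else a.arrow.t ω

def Letter.t {n : ℕ} (ω : Fin n → Bool) (a : Letter n) : Fin (n + 1) :=
  if a.direct then a.arrow.t ω else a.arrow.s ω

/-- Words over an alphabet `A`: the trivial words `𝟙ᵢ` (`triv i true`) and `𝟙ᵢ⁻¹`
(`triv i false`), and words in the letters. The empty list of letters is not a string. -/
inductive Word (n : ℕ) (A : Type)
  | triv (i : Fin (n + 1)) (pos : Bool) : Word n A
  | letters (l : List A) : Word n A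
deriving DecidableEq

instance {n : ℕ} {A : Type} : Inhabited (Word n A) := ⟨.triv 0 true⟩

/-- The inverse `w_l⁻¹ ⋯ w₁⁻¹` of a word `w₁ ⋯ w_l`. -/
def Word.inv {n : ℕ} : Word n (Letter n) → Word n (Letter n)
  | .triv i b => .triv i (!b)
  | .letters l => .letters (l.map Letter.inv).reverse

/-- The number of letters. -/
def Word.length {n : ℕ} {A : Type} : Word n A → ℕ
  | .triv _ _ => 0
  | .letters l => l.length

/-- Concatenation (to be used for compatible strings only); trivial words are neutral. -/
def Word.mul {n : ℕ} {A : Type} : Word n A → Word n A → Word n A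
  | .triv _ _, w => w
  | .letters l, .triv _ _ => .letters l
  | .letters l, .letters m => .letters (l ++ m)

/-- The letter `b` may follow the letter `a` in a string. -/
def Follows {n : ℕ} (ω : Fin n → Bool) (a b : Letter n) : Prop :=
  a.s ω = b.t ω ∧ a ≠ b ∧ a ≠ b.inv

/-- Strings. -/
def IsString {n : ℕ} (ω : Fin n → Bool) : Word n (Letter n) → Prop
  | .triv _ _ => True
  | .letters l => l ≠ [] ∧ l.IsChain (Follows ω)

/-- The trivial word `𝟙ᵢ^{±1}` with `𝟙ᵢ^{±1} a = a`. A letter is read from its terminal point to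
its starting point: `𝟙ᵢ` precedes letters which go from `i` to `i + 1`, `𝟙ᵢ⁻¹` precedes letters
which go from `i` to `i - 1`. Moreover `𝟙ₙ εₙ^{±1} = εₙ^{±1}`, and
`𝟙₀⁻¹ ε₀^{±1} = ε₀^{±1}` (the inverse of `ε₀^{±1} 𝟙₀ = ε₀^{±1}`). -/
def Letter.unitT {n : ℕ} (ω : Fin n → Bool) (a : Letter n) : Fin (n + 1) × Bool :=
  match a.arrow with
  | .eps0 => (0, false)
  | .epsN => (Fin.last n, true)
  | .eta k => (a.t ω, a.direct == ω k)

/-- The trivial word `𝟙ᵢ^{±1}` with `a 𝟙ᵢ^{±1} = a`. It is the inverse of the trivial word which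
may precede `a⁻¹`. -/
def Letter.unitS {n : ℕ} (ω : Fin n → Bool) (a : Letter n) : Fin (n + 1) × Bool :=
  match a.arrow with
  | .eps0 => (0, true)
  | .epsN => (Fin.last n, false)
  | .eta k => (a.s ω, a.direct == ω k)

/-- Two strings are compatible, i.e. their concatenation is defined (and is a string). -/
def Composable {n : ℕ} (ω : Fin n → Bool) : Word n (Letter n) → Word n (Letter n) → Prop
  | .triv i b, .triv j c => i = j ∧ b = c
  | .triv i b, .letters m => ∃ a ∈ m.head?, a.unitT ω = (i, b)
  | .letters l, .triv i b => ∃ a ∈ l.getLast?, a.unitS ω = (i, b)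
  | .letters l, .letters m => ∃ a ∈ l.getLast?, ∃ b ∈ m.head?, Follows ω a b

/-- Words without inverse letters (`d = true`), resp. without direct letters (`d = false`). Trivial
words of either sign count as both. -/
def IsPure {n : ℕ} (d : Bool) : Word n (Letter n) → Prop
  | .triv _ _ => True
  | .letters l => ∀ a ∈ l, a.direct = d

/-- Direct strings. -/
def IsDirectString {n : ℕ} (ω : Fin n → Bool) (w : Word n (Letter n)) : Prop :=
  IsString ω w ∧ IsPure true w

/-- Inverse strings. -/
def IsInverseString {n : ℕ} (ω : Fin n → Bool) (w : Word n (Letter n)) : Prop :=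
  IsString ω w ∧ IsPure false w

/-- If `s(w) ∈ {0, n}` for a string with last letter `a`, then `a = ε_{s(w)}^{±1}`. -/
def Letter.GoodEnd {n : ℕ} (ω : Fin n → Bool) (a : Letter n) : Prop :=
  (a.s ω = 0 → a.arrow = .eps0) ∧ (a.s ω = Fin.last n → a.arrow = .epsN)

/-- If `t(w) ∈ {0, n}` for a string with first letter `a`, then `a = ε_{t(w)}^{±1}`. -/
def Letter.GoodStart {n : ℕ} (ω : Fin n → Bool) (a : Letter n) : Prop :=
  (a.t ω = 0 → a.arrow = .eps0) ∧ (a.t ω = Fin.last n → a.arrow = .epsN)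

/-- The condition which singles out the locally free strings. -/
def IsLocallyFree {n : ℕ} (ω : Fin n → Bool) : Word n (Letter n) → Prop
  | .triv i _ => ¬ IsEnd i
  | .letters l => (∀ a ∈ l.getLast?, a.GoodEnd ω) ∧ (∀ a ∈ l.head?, a.GoodStart ω)

/-- The set of locally free strings. -/
def lfStrings {n : ℕ} (ω : Fin n → Bool) : Set (Word n (Letter n)) :=
  {w | IsString ω w ∧ IsLocallyFree ω w}

/-- The sequence of vertices `t(w₁), …, t(w_l), s(w_l)` which a word runs through. -/
def Word.vertices {n : ℕ} (ω : Fin n → Bool) : Word n (Letter n) → List (Fin (n + 1))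
  | .triv i _ => [i]
  | .letters l => l.map (Letter.t ω) ++ (l.getLast?.map (Letter.s ω)).toList

/-- The rank vector of a locally free string. (A locally free string runs an even number of times
through each of the vertices `0` and `n`.) -/
def rk {n : ℕ} (ω : Fin n → Bool) (w : Word n (Letter n)) : Fin (n + 1) → ℤ := fun i =>
  if IsEnd i then (((w.vertices ω).count i / 2 : ℕ) : ℤ) else ((w.vertices ω).count i : ℤ)

/-- The fibre of the rank function on locally free strings. -/
def rkFiber {n : ℕ} (ω : Fin n → Bool) (α : Fin (n + 1) → ℤ) : Set (Word n (Letter n)) :=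
  {w | w ∈ lfStrings ω ∧ rk ω w = α}

/-! ### Similarity -/

/-- The letters `ηₖ^{±1}` and `ε₀*`, `εₙ*`. -/
inductive StarLetter (n : ℕ)
  | eps0 : StarLetter n
  | epsN : StarLetter n
  | eta (k : Fin n) (direct : Bool) : StarLetter n
deriving DecidableEq

/-- The projection which forgets the exponent `±1` of the letters `ε₀^{±1}`, `εₙ^{±1}`. -/
def Letter.toStar {n : ℕ} (a : Letter n) : StarLetter n :=
  match a.arrow with
  | .eps0 => .eps0
  | .epsN => .epsN
  | .eta k => .eta k a.direct

def Word.toStar {n : ℕ} : Word n (Letter n) → Word n (StarLetter n)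
  | .triv i b => .triv i b
  | .letters l => .letters (l.map Letter.toStar)

/-- The similarity class `[w]`. -/
def simClass {n : ℕ} (ω : Fin n → Bool) (w : Word n (Letter n)) : Set (Word n (Letter n)) :=
  {v | IsString ω v ∧ v.toStar = w.toStar}

/-! ### Basic locally free strings and their shifts -/

/-- `w` is a word of maximal length with property `P`. -/
def IsLongest {n : ℕ} (P : Word n (Letter n) → Prop) (w : Word n (Letter n)) : Prop :=
  P w ∧ ∀ v, P v → v.length ≤ w.length

/-- The longest word with property `P`; it is used where there is exactly one. -/
noncomputable def longest {n : ℕ} (P : Word n (Letter n) → Prop) : Word n (Letter n) :=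
  Classical.epsilon (IsLongest P)

/-- The one-letter word `η_{k+1}`. -/
def etaWord {n : ℕ} (k : Fin n) : Word n (Letter n) := .letters [⟨.eta k, true⟩]

/-- The one-letter word `η_{k+1}⁻¹`. -/
def etaInvWord {n : ℕ} (k : Fin n) : Word n (Letter n) := .letters [⟨.eta k, false⟩]

/-- The projective string `pᵢ`: the longest direct string ending in `i` followed by the longest
inverse string starting in `i`. -/
noncomputable def projString {n : ℕ} (ω : Fin n → Bool) (i : Fin (n + 1)) : Word n (Letter n) :=
  (longest fun v => IsDirectString ω v ∧ Composable ω v (.triv i true)).mul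
    (longest fun v => IsInverseString ω v ∧ Composable ω (.triv i true) v)

/-- The injective string `qᵢ`: the longest inverse string ending in `i` followed by the longest
direct string starting in `i`. -/
noncomputable def injString {n : ℕ} (ω : Fin n → Bool) (i : Fin (n + 1)) : Word n (Letter n) :=
  (longest fun v => IsInverseString ω v ∧ Composable ω v (.triv i true)).mul
    (longest fun v => IsDirectString ω v ∧ Composable ω (.triv i true) v)

/-- The simple regular string `r_{k+1}`: the longest inverse string such that the hook
`η_{k+1} r_{k+1}` is a string. -/
noncomputable def regString {n : ℕ} (ω : Fin n → Bool) (k : Fin n) : Word n (Letter n) :=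
  longest fun v => IsInverseString ω v ∧ Composable ω (etaWord k) v

/-- The string `r'_{k+1}`: the longest direct string such that the co-hook
`η_{k+1}⁻¹ r'_{k+1}` is a string. -/
noncomputable def coregString {n : ℕ} (ω : Fin n → Bool) (k : Fin n) : Word n (Letter n) :=
  longest fun v => IsDirectString ω v ∧ Composable ω (etaInvWord k) v

open Classical in
/-- The string `w[1]`: if `w η_k` is a string for some `k` (which is then unique), add the hook
`η_k r_k` on the right. The value is irrelevant (namely `w`) if there is no such `k`. -/
noncomputable def hookR {n : ℕ} (ω : Fin n → Bool) (w : Word n (Letter n)) : Word n (Letter n) :=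
  if h : ∃ k, Composable ω w (etaWord k) then
    (w.mul (etaWord h.choose)).mul (regString ω h.choose)
  else w

open Classical in
/-- The string `w[-1]`: if `w η_k⁻¹` is a string for some `k` (which is then unique), add the
co-hook `η_k⁻¹ r'_k` on the right. The value is irrelevant (namely `w`) if there is no such
`k`. -/
noncomputable def cohookR {n : ℕ} (ω : Fin n → Bool) (w : Word n (Letter n)) :
    Word n (Letter n) :=
  if h : ∃ k, Composable ω w (etaInvWord k) then
    (w.mul (etaInvWord h.choose)).mul (coregString ω h.choose)
  else w

/-- The string `[1]w`. -/
noncomputable def hookL {n : ℕ} (ω : Fin n → Bool) (w : Word n (Letter n)) : Word n (Letter n) :=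
  (hookR ω w.inv).inv

/-- The string `[-1]w`. -/
noncomputable def cohookL {n : ℕ} (ω : Fin n → Bool) (w : Word n (Letter n)) :
    Word n (Letter n) :=
  (cohookR ω w.inv).inv

/-- The preprojective string `[k] pᵢ [k]`. -/
noncomputable def preprojString {n : ℕ} (ω : Fin n → Bool) (i : Fin (n + 1)) (k : ℕ) :
    Word n (Letter n) :=
  (hookL ω)^[k] ((hookR ω)^[k] (projString ω i))

/-- The regular string `rᵢ [k]`. -/
noncomputable def regularString {n : ℕ} (ω : Fin n → Bool) (i : Fin n) (k : ℕ) :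
    Word n (Letter n) :=
  (hookR ω)^[k] (regString ω i)

/-- The preinjective string `[-k] qᵢ [-k]`. -/
noncomputable def preinjString {n : ℕ} (ω : Fin n → Bool) (i : Fin (n + 1)) (k : ℕ) :
    Word n (Letter n) :=
  (cohookL ω)^[k] ((cohookR ω)^[k] (injString ω i))

/-- The `τ`-locally free strings: the locally free strings which are preprojective, regular or
preinjective. -/
def tauStrings {n : ℕ} (ω : Fin n → Bool) : Set (Word n (Letter n)) :=
  {w | w ∈ lfStrings ω ∧
    ((∃ i k, w = preprojString ω i k ∨ w = (preprojString ω i k).inv) ∨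
     (∃ i k, w = regularString ω i k ∨ w = (regularString ω i k).inv) ∨
     (∃ i k, w = preinjString ω i k ∨ w = (preinjString ω i k).inv))}

/-- The union `[w] ∪ [w⁻¹]`. -/
def simClassPM {n : ℕ} (ω : Fin n → Bool) (w : Word n (Letter n)) : Set (Word n (Letter n)) :=
  simClass ω w ∪ simClass ω w.inv

end CTilde

namespace CTilde

/-! Give each vertex an upward and a downward version. The resulting `2 * n + 2` places form one
cycle, along which every letter moves by one step: the η-letters keep the direction and the loops at
`0` and `n` reverse it. A string is thus a piece of a walk that never has a choice except for the
exponents of loops, and its similarity class is its starting place together with its length. On the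
universal cover `ℤ` of the cycle, a string is an interval, and inversion is a reflection.

A locally free string is one that neither starts just after a loop has been left out nor stops where
a loop is due. After contracting the loops it becomes a pair `A ≤ B` (`Spans`), unique up to
simultaneous translation by `2 * n`; inversion sends it to `(-B, -A)`. Its rank vector is the sum of
the simple roots at the vertices `fold n A`, …, `fold n B` (`Spans.rk_eq`), written `rootBetween n A
(B + 1)`.

On these sums the Weyl group acts by moving the two endpoints separately (`reflect_rootBetween`), as
affine permutations of `ℤ` commuting with translation by `2 * n`. Hence real roots have endpoints
incongruent modulo `2 * n`. The invariant form is a sum over pairs of endpoints, so it detects them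
up to translation and inversion (`rootBetween_injective`) and shows that a root is long iff `2 * n ∣
A + B`. This is also the condition for `(A, B)` and `(-B, -A)` to be translates, that is, for the
string to be similar to its inverse.

The defect telescopes as well, to twice a difference of two indicators: whether the step leaving `B`
is direct, and whether the step leaving `-A`, the end of the inverse string, is inverse. Adding a
hook (cohook) on the right moves `B` to the next direct (inverse) step. Counting such steps with
`stepCount` therefore gives coordinates for the τ-locally free strings: if both exit steps have the
same type `t`, the difference of the two counts, modulo `2 * n` and sign, is the vertex `i`, and
their sum gives `k` (`extendedString_unique`, `exists_extendedString`); `t = true` is the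
preprojective and `t = false` the preinjective case. If the types differ, one of the string and its
inverse has the shape of `r_i[k]`, where the entering arrow gives `i` and the count gives `k`
(`regularString_unique`, `exists_regularString`). -/

variable {n : ℕ} {ω : Fin n → Bool}

/-! ### Oriented vertices and the letters between them -/

/-- An oriented vertex: the sign says whether a walk through it goes up or down. -/
abbrev Place (n : ℕ) := Fin (n + 1) × Bool

/-- The same vertex with the opposite orientation. -/
def Place.flip (v : Place n) : Place n := (v.1, !v.2)

@[simp] theorem Place.flip_flip (v : Place n) : v.flip.flip = v := by simp [Place.flip]

theorem Place.flip_inj {v w : Place n} : v.flip = w.flip ↔ v = w :=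
  ⟨fun h => by rw [← v.flip_flip, h, w.flip_flip], fun h => by rw [h]⟩

/-- The successor of an oriented vertex on the cycle `0, 1, …, n, n, …, 1, 0`. -/
def Place.next : Place n → Place n
  | (i, true) => if h : i.val < n then (⟨i.val + 1, by omega⟩, true) else (i, false)
  | (i, false) => if 0 < i.val then (⟨i.val - 1, by omega⟩, false) else (i, true)

/-- The places from which a string continues with a loop. -/
def Place.AtLoop (v : Place n) : Prop := v = (0, false) ∨ v = (Fin.last n, true)

/-- The place at which a letter begins. -/
def Letter.src (ω : Fin n → Bool) (a : Letter n) : Place n :=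
  match a.arrow with
  | .eps0 => (0, false)
  | .epsN => (Fin.last n, true)
  | .eta k => (a.t ω, a.direct == ω k)

/-- The place at which a letter ends. -/
def Letter.tgt (ω : Fin n → Bool) (a : Letter n) : Place n :=
  match a.arrow with
  | .eps0 => (0, true)
  | .epsN => (Fin.last n, false)
  | .eta k => (a.s ω, a.direct == ω k)

theorem Letter.unitT_eq_src (a : Letter n) : a.unitT ω = a.src ω := rfl

theorem Letter.unitS_eq_tgt (a : Letter n) : a.unitS ω = a.tgt ω := rfl

theorem Letter.tgt_eq_next (hn : 0 < n) (a : Letter n) : a.tgt ω = (a.src ω).next := by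
  obtain ⟨a, d⟩ := a
  cases a with
  | eps0 => simp [Letter.tgt, Letter.src, Place.next]
  | epsN => simp [Letter.tgt, Letter.src, Place.next]
  | eta k =>
    have hk := k.isLt
    cases h : ω k <;> cases d <;>
      simp [Letter.tgt, Letter.src, Place.next, Letter.s, Letter.t, Arrow.s, Arrow.t, h,
        Fin.ext_iff]

@[simp] theorem Letter.inv_inv (a : Letter n) : a.inv.inv = a := by simp [Letter.inv]

theorem Letter.src_inv (a : Letter n) : a.inv.src ω = (a.tgt ω).flip := by
  obtain ⟨a, d⟩ := a
  cases a <;> cases d <;>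
    simp [Letter.tgt, Letter.src, Place.flip, Letter.s, Letter.t, Letter.inv]

theorem Letter.tgt_inv (a : Letter n) : a.inv.tgt ω = (a.src ω).flip := by
  rw [← Place.flip_inj, ← Letter.src_inv, inv_inv, Place.flip_flip]

theorem Letter.src_fst (a : Letter n) : (a.src ω).1 = a.t ω := by
  obtain ⟨a, d⟩ := a
  cases a <;> cases d <;> simp [Letter.src, Letter.t, Arrow.t, Arrow.s]

theorem Letter.tgt_fst (a : Letter n) : (a.tgt ω).1 = a.s ω := by
  obtain ⟨a, d⟩ := a
  cases a <;> cases d <;> simp [Letter.tgt, Letter.s, Arrow.t, Arrow.s]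

/-- Only one arrow leads on from each place, with a forced exponent unless it is a loop; the proof
is a case check. -/
theorem Letter.toStar_eq_iff (hn : 0 < n) (a b : Letter n) :
    a.toStar = b.toStar ↔ a.src ω = b.src ω := by
  obtain ⟨a, d⟩ := a
  obtain ⟨b, e⟩ := b
  cases a with
  | eps0 =>
    cases b with
    | eps0 => simp [Letter.toStar, Letter.src]
    | epsN => simp [Letter.toStar, Letter.src]
    | eta k =>
      have := k.isLt
      cases h : ω k <;> cases e <;>
        simp [Letter.toStar, Letter.src, Letter.t, Arrow.s, Arrow.t, h, Fin.ext_iff]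
  | epsN =>
    cases b with
    | eps0 => simp [Letter.toStar, Letter.src]
    | epsN => simp [Letter.toStar, Letter.src]
    | eta k =>
      have := k.isLt
      cases h : ω k <;> cases e <;>
        simp [Letter.toStar, Letter.src, Letter.t, Arrow.s, Arrow.t, h, Fin.ext_iff] <;> omega
  | eta j =>
    have := j.isLt
    cases b with
    | eps0 =>
      cases h : ω j <;> cases d <;>
        simp [Letter.toStar, Letter.src, Letter.t, Arrow.s, Arrow.t, h, Fin.ext_iff]
    | epsN =>
      cases h : ω j <;> cases d <;>
        simp [Letter.toStar, Letter.src, Letter.t, Arrow.s, Arrow.t, h, Fin.ext_iff] <;> omega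
    | eta k =>
      have := k.isLt
      by_cases hjk : j = k
      · subst hjk
        cases h : ω j <;> cases d <;> cases e <;>
          simp [Letter.toStar, Letter.src, Letter.t, Arrow.s, Arrow.t, h, Fin.ext_iff]
      · have hjk' := hjk
        rw [Fin.ext_iff] at hjk'
        cases h : ω j <;> cases h' : ω k <;> cases d <;> cases e <;>
          simp [Letter.toStar, Letter.src, Letter.t, Arrow.s, Arrow.t, h, h', Fin.ext_iff, hjk']

/-- Forbidding `b = a` and `b = a⁻¹` forbids turning back at a vertex and repeating a loop. So an
η-letter reaching an end must be followed by the loop, and a loop by the η-letter leading away. -/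
theorem follows_iff (hn : 0 < n) (a b : Letter n) :
    Follows ω a b ↔ a.tgt ω = b.src ω := by
  obtain ⟨a, d⟩ := a
  obtain ⟨b, e⟩ := b
  cases a with
  | eps0 =>
    cases b with
    | eps0 => cases d <;> cases e <;> simp [Follows, Letter.tgt, Letter.src, Letter.inv]
    | epsN =>
      cases d <;> cases e <;>
        simp [Follows, Letter.tgt, Letter.src, Letter.s, Letter.t, Arrow.s, Arrow.t,
          Letter.inv, Fin.ext_iff]
    | eta k =>
      have := k.isLt
      cases h : ω k <;> cases d <;> cases e <;>
        simp [Follows, Letter.tgt, Letter.src, Letter.s, Letter.t, Arrow.s, Arrow.t,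
          Letter.inv, h, Fin.ext_iff]
  | epsN =>
    cases b with
    | eps0 =>
      cases d <;> cases e <;>
        simp [Follows, Letter.tgt, Letter.src, Letter.s, Letter.t, Arrow.s, Arrow.t,
          Letter.inv, Fin.ext_iff]
    | epsN => cases d <;> cases e <;> simp [Follows, Letter.tgt, Letter.src, Letter.inv]
    | eta k =>
      have := k.isLt
      cases h : ω k <;> cases d <;> cases e <;>
        simp [Follows, Letter.tgt, Letter.src, Letter.s, Letter.t, Arrow.s, Arrow.t,
          Letter.inv, h, Fin.ext_iff] <;> omega
  | eta j =>
    have := j.isLt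
    cases b with
    | eps0 =>
      cases h : ω j <;> cases d <;> cases e <;>
        simp [Follows, Letter.tgt, Letter.src, Letter.s, Letter.t, Arrow.s, Arrow.t,
          Letter.inv, h, Fin.ext_iff]
    | epsN =>
      cases h : ω j <;> cases d <;> cases e <;>
        simp [Follows, Letter.tgt, Letter.src, Letter.s, Letter.t, Arrow.s, Arrow.t,
          Letter.inv, h, Fin.ext_iff] <;> omega
    | eta k =>
      have := k.isLt
      cases h : ω j <;> cases h' : ω k <;> cases d <;> cases e <;>
        simp [Follows, Letter.tgt, Letter.src, Letter.s, Letter.t, Arrow.s, Arrow.t,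
          Letter.inv, h, h', Fin.ext_iff] <;> grind

/-- The letters which lead from a place to the next one; the sign matters only for loops. -/
def Place.step (ω : Fin n → Bool) (v : Place n) (d : Bool) : Letter n :=
  match v with
  | (i, true) => if h : i.val < n then ⟨.eta ⟨i.val, h⟩, ω ⟨i.val, h⟩⟩ else ⟨.epsN, d⟩
  | (i, false) =>
    if h : 0 < i.val then ⟨.eta ⟨i.val - 1, by omega⟩, !ω ⟨i.val - 1, by omega⟩⟩ else ⟨.eps0, d⟩

theorem Place.src_step (v : Place n) (d : Bool) : (v.step ω d).src ω = v := by
  obtain ⟨i, b⟩ := v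
  have := i.isLt
  cases b
  · by_cases h : 0 < i.val
    · cases h' : ω ⟨i.val - 1, by omega⟩ <;>
        simp [Place.step, h, Letter.src, Letter.t, Arrow.t, Arrow.s, h', Fin.ext_iff] <;> omega
    · simp [Place.step, h, Letter.src, Fin.ext_iff]; omega
  · by_cases h : i.val < n
    · cases h' : ω ⟨i.val, h⟩ <;>
        simp [Place.step, h, Letter.src, Letter.t, Arrow.t, Arrow.s, h']
    · simp [Place.step, h, Letter.src, Fin.ext_iff]; omega

theorem Place.step_direct_of_not_atLoop {v : Place n} (hv : ¬ v.AtLoop) (d e : Bool) :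
    (v.step ω d).direct = (v.step ω e).direct := by
  obtain ⟨i, b⟩ := v
  have := i.isLt
  simp only [Place.AtLoop, Prod.mk.injEq, Fin.ext_iff, not_or, not_and] at hv
  cases b
  · have h : 0 < i.val := by simpa [Nat.pos_iff_ne_zero] using hv.1
    simp [Place.step, h]
  · have h : i.val < n := by have := hv.2; simp at this; omega
    simp [Place.step, h]

theorem Place.step_direct_of_atLoop {v : Place n} (hv : v.AtLoop) (d : Bool) :
    (v.step ω d).direct = d := by
  rcases hv with rfl | rfl <;> simp [Place.step]

theorem Letter.eq_step (hn : 0 < n) (a : Letter n) : a = (a.src ω).step ω a.direct := by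
  have h := (Letter.toStar_eq_iff (ω := ω) hn a ((a.src ω).step ω a.direct)).2
    (Place.src_step _ _).symm
  obtain ⟨a, d⟩ := a
  by_cases hv : (Letter.src ω ⟨a, d⟩).AtLoop
  · have h2 := Place.step_direct_of_atLoop (ω := ω) hv d
    generalize (Letter.src ω ⟨a, d⟩).step ω d = b at h h2
    obtain ⟨b, e⟩ := b
    cases a <;> cases b <;> simp_all [Letter.toStar]
  · cases a with
    | eps0 => exact absurd (Or.inl rfl) hv
    | epsN => exact absurd (Or.inr rfl) hv
    | eta k =>
      generalize Place.step ω (Letter.src ω ⟨Arrow.eta k, d⟩) d = b at h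
      obtain ⟨b, e⟩ := b
      cases b <;> simp_all [Letter.toStar]

/-- A string violates local freeness at its end exactly when it stops at an end vertex before taking
the loop. -/
theorem Letter.goodEnd_iff (hn : 0 < n) (a : Letter n) :
    a.GoodEnd ω ↔ ¬ (a.tgt ω).AtLoop := by
  obtain ⟨a, d⟩ := a
  cases a with
  | eps0 => simp [Letter.GoodEnd, Letter.tgt, Place.AtLoop, Letter.s, Arrow.s, Arrow.t,
      Fin.ext_iff]
  | epsN => simp [Letter.GoodEnd, Letter.tgt, Place.AtLoop, Letter.s, Arrow.s, Arrow.t,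
      Fin.ext_iff]
  | eta k =>
    have := k.isLt
    cases h : ω k <;> cases d <;>
      simp [Letter.GoodEnd, Letter.tgt, Place.AtLoop, Letter.s, Arrow.s, Arrow.t, h,
        Fin.ext_iff] <;> omega

theorem Letter.goodStart_iff (hn : 0 < n) (a : Letter n) :
    a.GoodStart ω ↔ ¬ (a.src ω).flip.AtLoop := by
  rw [← Letter.tgt_inv, ← Letter.goodEnd_iff hn]
  simp only [Letter.GoodEnd, Letter.GoodStart, Letter.inv]
  have : Letter.s ω ⟨a.arrow, !a.direct⟩ = a.t ω := by
    cases h : a.direct <;> simp [Letter.s, Letter.t, h]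
  rw [this]

/-! ### Words as walks -/

/-- The place where a word begins. -/
def Word.start (ω : Fin n → Bool) : Word n (Letter n) → Place n
  | .triv i b => (i, b)
  | .letters l => (l.head?.map (Letter.src ω)).getD (0, true)

/-- The place where a word ends. -/
def Word.finish (ω : Fin n → Bool) : Word n (Letter n) → Place n
  | .triv i b => (i, b)
  | .letters l => (l.getLast?.map (Letter.tgt ω)).getD (0, true)

@[simp] theorem Word.inv_inv (w : Word n (Letter n)) : w.inv.inv = w := by
  cases w with
  | triv i b => simp [Word.inv]
  | letters l =>
    have : Letter.inv ∘ Letter.inv = (id : Letter n → Letter n) := by ext1 a; simp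
    simp [Word.inv, this]

@[simp] theorem Word.length_inv (w : Word n (Letter n)) : w.inv.length = w.length := by
  cases w <;> simp [Word.inv, Word.length]

theorem IsString.inv (hn : 0 < n) {w : Word n (Letter n)} (h : IsString ω w) :
    IsString ω w.inv := by
  cases w with
  | triv i b => trivial
  | letters l =>
    refine ⟨by simpa using h.1, ?_⟩
    rw [List.isChain_reverse, List.isChain_map]
    refine h.2.imp fun a b hab => ?_
    simp only [follows_iff hn, Letter.tgt_inv, Letter.src_inv, Place.flip_inj] at hab ⊢
    exact hab.symm

theorem IsPure.inv {d : Bool} {w : Word n (Letter n)} (h : IsPure d w) : IsPure (!d) w.inv := by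
  cases w with
  | triv i b => trivial
  | letters l =>
    intro a ha
    simp only [List.mem_reverse, List.mem_map] at ha
    obtain ⟨b, hb, rfl⟩ := ha
    simp [Letter.inv, h b hb]

theorem IsString.start_inv {w : Word n (Letter n)} (h : IsString ω w) :
    w.inv.start ω = (w.finish ω).flip := by
  cases w with
  | triv i b => rfl
  | letters l =>
    obtain ⟨a, ha⟩ : ∃ a, l.getLast? = some a := by
      rw [← Option.isSome_iff_exists]; simpa using h.1
    simp [Word.inv, Word.start, Word.finish, ha, Letter.src_inv]

theorem IsString.finish_inv (hn : 0 < n) {w : Word n (Letter n)} (h : IsString ω w) :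
    w.inv.finish ω = (w.start ω).flip := by
  rw [← Place.flip_inj, ← (h.inv hn).start_inv, Word.inv_inv, Place.flip_flip]

theorem composable_iff (hn : 0 < n) {v w : Word n (Letter n)} (hv : IsString ω v)
    (hw : IsString ω w) : Composable ω v w ↔ v.finish ω = w.start ω := by
  cases v with
  | triv i b =>
    cases w with
    | triv j c => simp [Composable, Word.finish, Word.start]
    | letters m =>
      obtain ⟨a, ha⟩ : ∃ a, m.head? = some a := by
        rw [← Option.isSome_iff_exists]; simpa using hw.1
      simp [Composable, Word.finish, Word.start, ha, Letter.unitT_eq_src, eq_comm]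
  | letters l =>
    obtain ⟨a, ha⟩ : ∃ a, l.getLast? = some a := by
      rw [← Option.isSome_iff_exists]; simpa using hv.1
    cases w with
    | triv j c => simp [Composable, Word.finish, Word.start, ha, Letter.unitS_eq_tgt]
    | letters m =>
      obtain ⟨b, hb⟩ : ∃ a, m.head? = some a := by
        rw [← Option.isSome_iff_exists]; simpa using hw.1
      simp [Composable, Word.finish, Word.start, ha, hb, follows_iff hn]

theorem IsString.mul (hn : 0 < n) {v w : Word n (Letter n)} (hv : IsString ω v)
    (hw : IsString ω w) (h : v.finish ω = w.start ω) : IsString ω (v.mul w) := by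
  rw [← composable_iff hn hv hw] at h
  cases v with
  | triv i b => exact hw
  | letters l =>
    cases w with
    | triv j c => exact hv
    | letters m =>
      obtain ⟨a, ha, b, hb, hab⟩ := h
      refine ⟨by simp [hv.1], List.isChain_append.2 ⟨hv.2, hw.2, ?_⟩⟩
      intro x hx y hy
      rw [Option.mem_def] at *
      rw [hx] at ha
      rw [hy] at hb
      cases ha
      cases hb
      exact hab

theorem Word.start_mul {v w : Word n (Letter n)} (hv : IsString ω v)
    (h : v.finish ω = w.start ω) : (v.mul w).start ω = v.start ω := by
  cases v with
  | triv i b => exact h.symm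
  | letters l =>
    cases w with
    | triv j c => rfl
    | letters m =>
      obtain ⟨a, l, rfl⟩ := List.exists_cons_of_ne_nil hv.1
      simp [Word.mul, Word.start]

theorem Word.length_mul (v w : Word n (Letter n)) : (v.mul w).length = v.length + w.length := by
  cases v <;> cases w <;> simp [Word.mul, Word.length]

/-- Rigidity of strings: composability leaves no freedom about the places that are visited. -/
theorem src_getElem (hn : 0 < n) {l : List (Letter n)} (h : IsString ω (.letters l)) :
    ∀ (j : ℕ) (hj : j < l.length),
      (l[j]).src ω = Place.next^[j] ((Word.letters l).start ω) := by
  intro j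
  induction j with
  | zero =>
    intro hj
    obtain ⟨a, l, rfl⟩ := List.exists_cons_of_ne_nil h.1
    simp [Word.start]
  | succ j ih =>
    intro hj
    rw [Function.iterate_succ_apply', ← ih (by omega), ← Letter.tgt_eq_next hn, eq_comm,
      ← follows_iff hn]
    exact List.isChain_iff_getElem.1 h.2 j hj

theorem IsString.finish_eq (hn : 0 < n) {w : Word n (Letter n)} (h : IsString ω w) :
    w.finish ω = Place.next^[w.length] (w.start ω) := by
  cases w with
  | triv i b => rfl
  | letters l =>
    have hl : 0 < l.length := List.length_pos_iff.2 h.1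
    obtain ⟨m, hm⟩ : ∃ m, l.length = m + 1 := ⟨l.length - 1, by omega⟩
    have := src_getElem hn h m (by omega)
    simp only [Word.length]
    rw [hm, Function.iterate_succ_apply', ← this, ← Letter.tgt_eq_next hn]
    simp [Word.finish, List.getLast?_eq_getElem?, hm]

theorem toStar_eq_iff (hn : 0 < n) {v w : Word n (Letter n)} (hv : IsString ω v)
    (hw : IsString ω w) :
    v.toStar = w.toStar ↔ v.start ω = w.start ω ∧ v.length = w.length := by
  cases v with
  | triv i b =>
    cases w with
    | triv j c => simp [Word.toStar, Word.start, Word.length]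
    | letters m =>
      have : m.length ≠ 0 := by simpa using hw.1
      simp [Word.toStar, Word.length, this.symm]
  | letters l =>
    cases w with
    | triv j c =>
      have : l.length ≠ 0 := by simpa using hv.1
      simp [Word.toStar, Word.length, this]
    | letters m =>
      have hl0 : 0 < l.length := List.length_pos_iff.2 hv.1
      simp only [Word.toStar, Word.letters.injEq, Word.length]
      constructor
      · intro h
        have hlen : l.length = m.length := by simpa using congrArg List.length h
        refine ⟨?_, hlen⟩
        have h1 := src_getElem hn hv 0 hl0
        have h2 := src_getElem hn hw 0 (by omega)
        simp only [Function.iterate_zero, id_eq] at h1 h2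
        rw [← h1, ← h2, ← Letter.toStar_eq_iff hn]
        have := List.getElem_of_eq h (i := 0) (by simpa using hl0)
        simpa using this
      · rintro ⟨hs, hlen⟩
        apply List.ext_getElem
        · simpa using hlen
        · intro j hj hj'
          simp only [List.length_map] at hj hj'
          simp only [List.getElem_map]
          rw [Letter.toStar_eq_iff (ω := ω) hn, src_getElem hn hv j hj,
            src_getElem hn hw j hj', hs]

theorem isLocallyFree_iff (hn : 0 < n) {w : Word n (Letter n)} (h : IsString ω w) :
    IsLocallyFree ω w ↔ ¬ (w.start ω).flip.AtLoop ∧ ¬ (w.finish ω).AtLoop := by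
  cases w with
  | triv i b =>
    cases b <;> simp [IsLocallyFree, Word.start, Word.finish, Place.flip, Place.AtLoop, IsEnd]
    tauto
  | letters l =>
    obtain ⟨a, ha⟩ : ∃ a, l.getLast? = some a := by
      rw [← Option.isSome_iff_exists]; simpa using h.1
    obtain ⟨b, hb⟩ : ∃ a, l.head? = some a := by
      rw [← Option.isSome_iff_exists]; simpa using h.1
    simp [IsLocallyFree, Word.start, Word.finish, ha, hb, Letter.goodEnd_iff hn,
      Letter.goodStart_iff hn, and_comm]

theorem vertices_eq (hn : 0 < n) {w : Word n (Letter n)} (h : IsString ω w) :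
    w.vertices ω = (List.range (w.length + 1)).map
      (fun j => (Place.next^[j] (w.start ω)).1) := by
  cases w with
  | triv i b => simp [Word.vertices, Word.length, Word.start]
  | letters l =>
    rw [List.range_succ, List.map_append, Word.vertices]
    congr 1
    · apply List.ext_getElem
      · simp [Word.length]
      · intro j hj hj'
        simp only [List.length_map] at hj
        simp [← src_getElem hn h j hj, Letter.src_fst]
    · obtain ⟨a, ha⟩ : ∃ a, l.getLast? = some a := by
        rw [← Option.isSome_iff_exists]; simpa using h.1
      simp [← h.finish_eq hn, ha, Word.finish, Letter.tgt_fst]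

/-- The string with given start and length whose loops have exponent `d`. -/
def walk (ω : Fin n → Bool) (v : Place n) (m : ℕ) (d : Bool) : Word n (Letter n) :=
  if m = 0 then .triv v.1 v.2
  else .letters ((List.range m).map fun j => (Place.next^[j] v).step ω d)

theorem isString_walk (hn : 0 < n) (v : Place n) (m : ℕ) (d : Bool) :
    IsString ω (walk ω v m d) := by
  unfold walk
  split_ifs with h
  · trivial
  · refine ⟨by simpa using h, ?_⟩
    rw [List.isChain_iff_getElem]
    intro j hj
    simp [follows_iff hn, Letter.tgt_eq_next hn, Place.src_step,
      Function.iterate_succ_apply']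

theorem start_walk (v : Place n) (m : ℕ) (d : Bool) : (walk ω v m d).start ω = v := by
  unfold walk
  split_ifs with h
  · rfl
  · obtain ⟨m, rfl⟩ := Nat.exists_eq_succ_of_ne_zero h
    simp [Word.start, List.range_succ_eq_map, Place.src_step]

theorem length_walk (v : Place n) (m : ℕ) (d : Bool) : (walk ω v m d).length = m := by
  unfold walk
  split_ifs with h
  · simp [Word.length, h]
  · simp [Word.length]

theorem isPure_walk {v : Place n} {m : ℕ} {d : Bool}
    (h : ∀ j < m, ((Place.next^[j] v).step ω d).direct = d) : IsPure d (walk ω v m d) := by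
  unfold walk
  split_ifs with hm
  · trivial
  · intro a ha
    simp only [List.mem_map, List.mem_range] at ha
    obtain ⟨j, hj, rfl⟩ := ha
    exact h j hj

theorem IsPure.step_direct (hn : 0 < n) {w : Word n (Letter n)} {d : Bool} (h : IsString ω w)
    (hd : IsPure d w) {j : ℕ} (hj : j < w.length) :
    ((Place.next^[j] (w.start ω)).step ω d).direct = d := by
  cases w with
  | triv i b => simp [Word.length] at hj
  | letters l =>
    simp only [Word.length] at hj
    have hd' := hd l[j] (List.getElem_mem hj)
    rw [← src_getElem hn h j hj]
    conv_lhs => rw [← hd']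
    rw [← Letter.eq_step hn, hd']

/-! ### The universal cover of the cycle of places -/

theorem exists_mul_add {m : ℤ} (hm : 0 < m) (p : ℤ) : ∃ q r, p = m * q + r ∧ 0 ≤ r ∧ r < m :=
  ⟨p / m, p % m, (Int.mul_ediv_add_emod p m).symm, Int.emod_nonneg p hm.ne', Int.emod_lt_of_pos p hm⟩

theorem mul_add_emod {m r : ℤ} (q : ℤ) (h0 : 0 ≤ r) (h1 : r < m) : (m * q + r) % m = r := by
  rw [Int.mul_add_emod_self_left, Int.emod_eq_of_lt h0 h1]

theorem mul_add_ediv {m r : ℤ} (q : ℤ) (h0 : 0 ≤ r) (h1 : r < m) : (m * q + r) / m = q := by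
  rw [Int.mul_add_ediv_left _ _ (by omega), Int.ediv_eq_zero_of_lt h0 h1, add_zero]

theorem dvd_mul_add_iff {m r : ℤ} (q : ℤ) (h0 : -m < r) (h1 : r < m) : m ∣ m * q + r ↔ r = 0 := by
  rw [Int.dvd_add_right (Dvd.intro _ rfl)]
  constructor
  · exact fun h => Int.eq_zero_of_abs_lt_dvd h (abs_lt.2 ⟨h0, h1⟩)
  · rintro rfl
    exact dvd_zero _

/-- The covering of the cycle of places by the integers. -/
def pos (n : ℕ) (p : ℤ) : Place n :=
  (⟨(min (p % (2 * n + 2)) (2 * n + 1 - p % (2 * n + 2))).toNat, by omega⟩,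
    decide (p % (2 * n + 2) ≤ n))

theorem pos_eq (q : ℤ) {r : ℤ} (h0 : 0 ≤ r) (h1 : r < 2 * n + 2) :
    pos n ((2 * n + 2) * q + r) = (⟨(min r (2 * n + 1 - r)).toNat, by omega⟩, decide (r ≤ n)) := by
  simp only [pos, mul_add_emod q h0 h1]

/-- Residues `0, …, n` are the upward vertices and `n + 1, …, 2 * n + 1` the downward ones, each
once. -/
theorem pos_eq_pos_iff (p q : ℤ) : pos n p = pos n q ↔ ((2 * n + 2 : ℤ)) ∣ p - q := by
  obtain ⟨x, r, rfl, h0, h1⟩ := exists_mul_add (m := 2 * n + 2) (by omega) p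
  obtain ⟨y, s, rfl, h2, h3⟩ := exists_mul_add (m := 2 * n + 2) (by omega) q
  rw [show (2 * (n : ℤ) + 2) * x + r - ((2 * n + 2) * y + s) = (2 * n + 2) * (x - y) + (r - s) by ring,
    dvd_mul_add_iff _ (by omega) (by omega), pos_eq _ h0 h1, pos_eq _ h2 h3]
  simp only [Prod.mk.injEq, Fin.mk.injEq, decide_eq_decide]
  omega

theorem next_pos (p : ℤ) : (pos n p).next = pos n (p + 1) := by
  obtain ⟨x, r, rfl, h0, h1⟩ := exists_mul_add (m := 2 * n + 2) (by omega) p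
  rw [pos_eq _ h0 h1]
  by_cases hr : r = 2 * n + 1
  · subst hr
    rw [show (2 * (n : ℤ) + 2) * x + (2 * n + 1) + 1 = (2 * n + 2) * (x + 1) + 0 by ring,
      pos_eq _ le_rfl (by omega)]
    have : ¬ (2 * (n : ℤ) + 1 ≤ n) := by omega
    simp [this, Place.next]
    rfl
  · rw [add_assoc, pos_eq _ (by omega) (by omega)]
    by_cases hrn : r ≤ n
    · simp only [hrn, decide_true, Place.next]
      split_ifs with h
      · have : r + 1 ≤ n := by omega
        simp only [this, decide_true, Prod.mk.injEq, Fin.mk.injEq, and_true]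
        omega
      · have : ¬ r + 1 ≤ n := by omega
        simp only [this, decide_false, Prod.mk.injEq, Fin.mk.injEq, and_true]
        omega
    · have h' : ¬ r + 1 ≤ n := by omega
      simp only [hrn, h', decide_false, Place.next]
      rw [if_pos (by omega)]
      simp only [Prod.mk.injEq, Fin.mk.injEq, and_true]
      omega

theorem next_iterate_pos (p : ℤ) (m : ℕ) : Place.next^[m] (pos n p) = pos n (p + m) := by
  induction m with
  | zero => simp
  | succ m ih => rw [Function.iterate_succ_apply', ih, next_pos]; push_cast; rw [add_assoc]

theorem flip_pos (p : ℤ) : (pos n p).flip = pos n (-1 - p) := by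
  obtain ⟨x, r, rfl, h0, h1⟩ := exists_mul_add (m := 2 * n + 2) (by omega) p
  rw [show -1 - ((2 * (n : ℤ) + 2) * x + r) = (2 * n + 2) * (-1 - x) + (2 * n + 1 - r) by ring,
    pos_eq _ h0 h1, pos_eq _ (by omega) (by omega)]
  simp only [Place.flip, Prod.mk.injEq, Fin.mk.injEq, ← decide_not, decide_eq_decide]
  omega

theorem pos_of_fin (i : Fin (n + 1)) : pos n i = (i, true) := by
  have := i.isLt
  have h := pos_eq (n := n) 0 (r := i) (by omega) (by omega)
  simp only [mul_zero, zero_add] at h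
  rw [h]
  simp only [Prod.mk.injEq, Fin.ext_iff, decide_eq_true_eq]
  omega

theorem exists_pos_eq (v : Place n) : ∃ p, pos n p = v := by
  obtain ⟨i, b⟩ := v
  cases b
  · exact ⟨-1 - i, by rw [← flip_pos, pos_of_fin]; rfl⟩
  · exact ⟨i, pos_of_fin i⟩

/-! ### Contracting the loops -/

/-- The position of the place in the universal cover where the walk leaves its `A`-th vertex, if
loops are not counted as steps. -/
def lift (n : ℕ) (A : ℤ) : ℤ := A + A / n

/-- The vertex of a walk after `A` steps from `0`, if loops are not counted as steps. -/
def fold (n : ℕ) (A : ℤ) : Fin (n + 1) :=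
  ⟨(min (A % (2 * n)) (2 * n - A % (2 * n))).toNat, by omega⟩

/-- The range of `r` exceeds one period so that both neighbours of a residue can be evaluated
without changing `q`. -/
theorem fold_val (q : ℤ) {r : ℤ} (h0 : -n ≤ r) (h1 : r ≤ 2 * n) :
    ((fold n (2 * n * q + r)).val : ℤ) = if r < 0 then -r else min r (2 * n - r) := by
  rcases Nat.eq_zero_or_pos n with rfl | hn
  · have : (fold 0 (2 * (0 : ℕ) * q + r)).val = 0 := by
      have := (fold 0 (2 * (0 : ℕ) * q + r)).isLt
      omega
    rw [this]
    split_ifs <;> omega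
  · have key : ∀ (q r : ℤ), 0 ≤ r → r < 2 * n →
        ((fold n (2 * n * q + r)).val : ℤ) = min r (2 * n - r) := by
      intro q r h0 h1
      simp only [fold, mul_add_emod q h0 h1]
      omega
    split_ifs with hr
    · rw [show 2 * (n : ℤ) * q + r = 2 * n * (q - 1) + (r + 2 * n) by ring,
        key _ _ (by omega) (by omega)]
      omega
    · by_cases hr' : r = 2 * n
      · rw [show 2 * (n : ℤ) * q + r = 2 * n * (q + 1) + 0 by rw [hr']; ring,
          key _ _ (by omega) (by omega)]
        omega
      · exact key _ _ (by omega) (by omega)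

/-- Every integer is congruent modulo `2 n` to an integer of absolute value at most `n`. -/
theorem exists_two_mul_add (hn : 0 < n) (A : ℤ) :
    ∃ q r, A = 2 * n * q + r ∧ -n < r ∧ r ≤ n := by
  obtain ⟨q, r, rfl, h0, h1⟩ := exists_mul_add (m := 2 * n) (by omega) A
  by_cases h : r ≤ n
  · exact ⟨q, r, rfl, by omega, h⟩
  · exact ⟨q + 1, r - 2 * n, by ring, by omega, by omega⟩

theorem fold_eq_iff_int (A : ℤ) (i : Fin (n + 1)) : fold n A = i ↔ ((fold n A).val : ℤ) = i := by
  rw [Fin.ext_iff]; omega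

theorem fold_coe (i : Fin (n + 1)) : fold n i = i := by
  have := i.isLt
  have h := fold_val (n := n) 0 (r := i) (by omega) (by omega)
  simp only [mul_zero, zero_add] at h
  rw [fold_eq_iff_int, h, if_neg (by omega)]
  omega

theorem fold_add_mul (A q : ℤ) : fold n (A + 2 * n * q) = fold n A := by
  simp only [fold, Int.add_mul_emod_self_left]

/-- `fold` is the quotient map of `ℤ` by the infinite dihedral group generated by negation and
translation by `2 * n`. -/
theorem fold_eq_fold_iff (hn : 0 < n) (A B : ℤ) :
    fold n A = fold n B ↔ (2 * n : ℤ) ∣ A - B ∨ (2 * n : ℤ) ∣ A + B := by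
  obtain ⟨x, r, rfl, h0, h1⟩ := exists_two_mul_add hn A
  obtain ⟨y, s, rfl, h2, h3⟩ := exists_two_mul_add hn B
  rw [fold_eq_iff_int, fold_val _ h0.le (by omega), fold_val _ h2.le (by omega),
    show 2 * (n : ℤ) * x + r - (2 * n * y + s) = (2 * n) * (x - y) + (r - s) by ring,
    show 2 * (n : ℤ) * x + r + (2 * n * y + s) = (2 * n) * (x + y) + (r + s) by ring,
    dvd_mul_add_iff _ (by omega) (by omega)]
  -- Both residues lie in `(-n, n]`, so this is the one case `r = s = n` where the sum may be a
  -- nonzero multiple of `2 * n`.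
  by_cases hrs : r + s = 2 * n
  · rw [hrs]
    have : (2 * n : ℤ) ∣ 2 * n * (x + y) + 2 * n := ⟨x + y + 1, by ring⟩
    simp only [this, or_true, iff_true]
    split_ifs <;> omega
  · rw [dvd_mul_add_iff _ (by omega) (by omega)]
    split_ifs <;> omega

theorem fold_neg (A : ℤ) : fold n (-A) = fold n A := by
  rcases Nat.eq_zero_or_pos n with rfl | hn
  · exact Fin.ext (by omega)
  · rw [fold_eq_fold_iff hn]
    right
    simp

theorem isEnd_fold_iff (hn : 0 < n) (A : ℤ) : IsEnd (fold n A) ↔ (n : ℤ) ∣ A := by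
  obtain ⟨x, r, rfl, h0, h1⟩ := exists_two_mul_add hn A
  have h : ∀ i : Fin (n + 1), IsEnd i ↔ (i.val : ℤ) = 0 ∨ (i.val : ℤ) = n := by
    intro i
    rw [IsEnd, Fin.ext_iff, Fin.ext_iff, Fin.val_zero, Fin.val_last]
    omega
  rw [h, fold_val _ h0.le (by omega)]
  by_cases hr : r = n
  · have : (n : ℤ) ∣ 2 * n * x + r := ⟨2 * x + 1, by rw [hr]; ring⟩
    simp only [this, iff_true]
    split_ifs <;> omega
  · rw [show 2 * (n : ℤ) * x + r = n * (2 * x) + r by ring, dvd_mul_add_iff _ (by omega) (by omega)]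
    split_ifs <;> omega

theorem lift_eq (hn : 0 < n) (q : ℤ) {r : ℤ} (h0 : 0 ≤ r) (h1 : r < 2 * n) :
    lift n (2 * n * q + r) = (2 * n + 2) * q + r + if r < n then 0 else 1 := by
  unfold lift
  split_ifs with h
  · rw [show 2 * (n : ℤ) * q + r = n * (2 * q) + r by ring, mul_add_ediv _ h0 h]
    ring
  · rw [show 2 * (n : ℤ) * q + r = n * (2 * q + 1) + (r - n) by ring,
      mul_add_ediv _ (by omega) (by omega)]
    ring

theorem pos_lift_fst (hn : 0 < n) (A : ℤ) : (pos n (lift n A)).1 = fold n A := by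
  obtain ⟨x, r, rfl, h0, h1⟩ := exists_mul_add (m := 2 * n) (by omega) A
  rw [lift_eq hn x h0 h1, add_assoc, pos_eq x (by split_ifs <;> omega) (by split_ifs <;> omega),
    eq_comm, fold_eq_iff_int, fold_val _ (by omega) (by omega)]
  simp only
  split_ifs <;> omega

theorem lift_add_mul (hn : 0 < n) (A q : ℤ) :
    lift n (A + 2 * n * q) = lift n A + (2 * n + 2) * q := by
  unfold lift
  rw [show A + 2 * (n : ℤ) * q = A + n * (2 * q) by ring, Int.add_mul_ediv_left _ _ (by omega)]
  ring

/-- Equivalently `lift n (-A) = -1 - (lift n (A - 1) + 1)`: the reflection `p ↦ -1 - p` of the cover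
takes the position entering the `A`-th vertex to the one leaving the `-A`-th. -/
theorem lift_neg (hn : 0 < n) (A : ℤ) : lift n (-A) = -2 - lift n (A - 1) := by
  unfold lift
  obtain ⟨q, r, rfl, h0, h1⟩ := exists_mul_add (m := n) (by omega) A
  by_cases hr : r = 0
  · subst hr
    rw [show -((n : ℤ) * q + 0) = n * (-q) + 0 by ring, mul_add_ediv _ le_rfl h1,
      show (n : ℤ) * q + 0 - 1 = n * (q - 1) + (n - 1) by ring,
      mul_add_ediv _ (by omega) (by omega)]
    ring
  · rw [show -((n : ℤ) * q + r) = n * (-q - 1) + (n - r) by ring,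
      mul_add_ediv _ (by omega) (by omega),
      show (n : ℤ) * q + r - 1 = n * q + (r - 1) by ring,
      mul_add_ediv _ (by omega) (by omega)]
    ring

theorem lift_lt_lift_iff {A B : ℤ} : lift n A < lift n B ↔ A < B := by
  have key : ∀ {A B : ℤ}, A < B → lift n A < lift n B := by
    intro A B h
    have : A / n ≤ B / n := by
      rcases Nat.eq_zero_or_pos n with rfl | hn
      · simp
      · exact Int.ediv_le_ediv (by omega) h.le
    unfold lift
    omega
  refine ⟨fun h => ?_, key⟩
  by_contra! h'
  rcases h'.lt_or_eq with h' | rfl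
  · exact absurd (key h') (by omega)
  · omega

theorem lift_le_lift_iff {A B : ℤ} : lift n A ≤ lift n B ↔ A ≤ B := by
  rw [← not_lt, lift_lt_lift_iff, not_lt]

theorem lift_injective : Function.Injective (lift n) := fun A B h =>
  le_antisymm (lift_le_lift_iff.1 h.le) (lift_le_lift_iff.1 h.ge)

/-- Passing an end vertex costs one extra position, for its loop. -/
theorem lift_add_one (hn : 0 < n) (A : ℤ) :
    lift n (A + 1) = lift n A + if IsEnd (fold n (A + 1)) then 2 else 1 := by
  unfold lift
  obtain ⟨q, r, rfl, h0, h1⟩ := exists_mul_add (m := n) (by omega) A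
  by_cases hr : r = n - 1
  · have h : IsEnd (fold n ((n : ℤ) * q + r + 1)) := by
      rw [isEnd_fold_iff hn]
      exact ⟨q + 1, by rw [hr]; ring⟩
    rw [if_pos h, mul_add_ediv _ h0 h1,
      show (n : ℤ) * q + r + 1 = n * (q + 1) + 0 by rw [hr]; ring,
      mul_add_ediv _ le_rfl (by omega), hr]
    ring
  · have h : ¬ IsEnd (fold n ((n : ℤ) * q + r + 1)) := by
      rw [isEnd_fold_iff hn, add_assoc, dvd_mul_add_iff _ (by omega) (by omega)]
      omega
    rw [if_neg h, mul_add_ediv _ h0 h1, add_assoc (_ * _) r 1,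
      mul_add_ediv _ (by omega) (by omega)]
    ring

theorem pos_lift_add_one_fst (hn : 0 < n) (A : ℤ) :
    (pos n (lift n A + 1)).1 = fold n (A + 1) := by
  have h : lift n A + 1 = -1 - lift n (-(A + 1)) := by
    rw [lift_neg hn]; ring_nf
  rw [h, ← flip_pos, ← fold_neg, ← pos_lift_fst hn]
  rfl

/-- Loops are due at the residues `n` and `2 * n + 1`, which are the ones that `lift` skips. -/
theorem not_atLoop_pos_iff (hn : 0 < n) (p : ℤ) : ¬ (pos n p).AtLoop ↔ ∃ A, p = lift n A := by
  obtain ⟨x, r, rfl, h0, h1⟩ := exists_mul_add (m := 2 * n + 2) (by omega) p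
  have h : (pos n ((2 * n + 2) * x + r)).AtLoop ↔ r = n ∨ r = 2 * n + 1 := by
    rw [pos_eq _ h0 h1]
    simp only [Place.AtLoop, Prod.mk.injEq, Fin.ext_iff, Fin.val_zero, Fin.val_last,
      decide_eq_false_iff_not, decide_eq_true_eq]
    omega
  rw [h]
  constructor
  · intro hr
    by_cases hrn : r < n
    · exact ⟨2 * n * x + r, by rw [lift_eq hn x h0 (by omega), if_pos hrn, add_zero]⟩
    · exact ⟨2 * n * x + (r - 1), by
        rw [lift_eq hn x (by omega) (by omega), if_neg (by omega)]; ring⟩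
  · rintro ⟨A, hA⟩ hr
    obtain ⟨y, s, rfl, h2, h3⟩ := exists_mul_add (m := 2 * n) (by omega) A
    rw [lift_eq hn y h2 h3] at hA
    have h4 : (2 * n + 2 : ℤ) ∣ (2 * n + 2) * (x - y) + (r - (s + if s < n then 0 else 1)) :=
      ⟨0, by linear_combination hA⟩
    rw [dvd_mul_add_iff _ (by split_ifs <;> omega) (by split_ifs <;> omega)] at h4
    split_ifs at h4 <;> omega

/-- Whether the step from the `A`-th vertex to the next one is a direct letter. -/
def isDirectStep (ω : Fin n → Bool) (A : ℤ) : Bool := ((pos n (lift n A)).step ω true).direct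

theorem step_pos_lift_direct (hn : 0 < n) (A : ℤ) (d : Bool) :
    ((pos n (lift n A)).step ω d).direct = isDirectStep ω A :=
  Place.step_direct_of_not_atLoop ((not_atLoop_pos_iff hn _).2 ⟨A, rfl⟩) _ _

theorem Letter.direct_eq_isDirectStep (hn : 0 < n) (a : Letter n) {A : ℤ}
    (h : a.src ω = pos n (lift n A)) : a.direct = isDirectStep ω A := by
  rw [← step_pos_lift_direct hn A a.direct, ← h, ← Letter.eq_step hn]

theorem isDirectStep_add_mul (hn : 0 < n) (A q : ℤ) :
    isDirectStep ω (A + 2 * n * q) = isDirectStep ω A := by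
  unfold isDirectStep
  rw [lift_add_mul hn, (pos_eq_pos_iff _ _).2 ⟨q, by ring⟩]

/-- The step from `-1 - A` to `-A` is the step from `A` to `A + 1` walked backwards, hence the
inverse letter. -/
theorem isDirectStep_neg (hn : 0 < n) (A : ℤ) :
    isDirectStep ω (-1 - A) = !isDirectStep ω A := by
  set a := (pos n (lift n A)).step ω true with ha
  have h1 : a.src ω = pos n (lift n A) := Place.src_step _ _
  have h2 : a.inv.src ω = pos n (lift n (-1 - A)) := by
    rw [Letter.src_inv, Letter.tgt_eq_next hn, h1, next_pos, flip_pos,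
      show -1 - A = -(A + 1) by ring, lift_neg hn]
    ring_nf
  rw [← a.direct_eq_isDirectStep hn h1, ← a.inv.direct_eq_isDirectStep hn h2]
  rfl

/-- The `η`-letter of the step from the `p`-th vertex. -/
theorem exists_eta_src (hn : 0 < n) (ω : Fin n → Bool) (p : ℤ) :
    ∃ k, Letter.src ω ⟨.eta k, isDirectStep ω p⟩ = pos n (lift n p) := by
  have h1 : Letter.src ω ((pos n (lift n p)).step ω true) = pos n (lift n p) :=
    Place.src_step _ _
  have h2 := step_pos_lift_direct (ω := ω) hn p true
  have h3 := (not_atLoop_pos_iff hn _).2 ⟨p, rfl⟩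
  rw [← h1] at h3
  generalize (pos n (lift n p)).step ω true = a at h1 h2 h3
  obtain ⟨a, d⟩ := a
  simp only at h2
  cases a with
  | eps0 => exact absurd (Or.inl rfl) h3
  | epsN => exact absurd (Or.inr rfl) h3
  | eta k => exact ⟨k, by rw [← h2]; exact h1⟩

/-! ### Indefinite sums over the integers -/

theorem eq_of_succ_eq {M : Type*} {f : ℤ → M} (h : ∀ x, f (x + 1) = f x) (x y : ℤ) :
    f x = f y := by
  have key : ∀ x, f x = f 0 := by
    intro x
    induction x using Int.induction_on with
    | zero => rfl
    | succ i ih => rw [h, ih]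
    | pred i ih => rw [← ih, ← h, sub_add_cancel]
  rw [key, key y]

/-- The indefinite sum of `g` which vanishes at `0`. -/
noncomputable def cum {M : Type*} [AddCommGroup M] (g : ℤ → M) (x : ℤ) : M :=
  ∑ p ∈ Finset.Ico 0 x, g p - ∑ p ∈ Finset.Ico x 0, g p

theorem cum_succ {M : Type*} [AddCommGroup M] (g : ℤ → M) (x : ℤ) :
    cum g (x + 1) = cum g x + g x := by
  unfold cum
  rcases le_or_gt 0 x with h | h
  · have h1 : Finset.Ico 0 (x + 1) = insert x (Finset.Ico 0 x) := by ext y; simp; omega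
    rw [h1, Finset.sum_insert (by simp), Finset.Ico_eq_empty_of_le (by omega : (0 : ℤ) ≤ x + 1),
      Finset.Ico_eq_empty_of_le h]
    simp [add_comm]
  · have h1 : Finset.Ico x 0 = insert x (Finset.Ico (x + 1) 0) := by ext y; simp; omega
    rw [h1, Finset.sum_insert (by simp), Finset.Ico_eq_empty_of_le (by omega : x + 1 ≤ (0 : ℤ)),
      Finset.Ico_eq_empty_of_le h.le]
    simp

/-- Two discrete antiderivatives of `g` differ by a constant. -/
theorem sub_eq_cum_sub_cum {M : Type*} [AddCommGroup M] {g H : ℤ → M}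
    (h : ∀ x, H (x + 1) = H x + g x) (x y : ℤ) : H y - H x = cum g y - cum g x := by
  have := eq_of_succ_eq (f := fun x => H x - cum g x) (fun x => by
    simp only [h, cum_succ]; abel) y x
  rw [sub_eq_sub_iff_add_eq_add] at this ⊢
  rw [this, add_comm]

/-! ### Sums of consecutive simple roots along the walk -/

/-- The sum `α_{fold A} + ⋯ + α_{fold (C - 1)}`, or minus the sum from `C` to `A - 1`. -/
noncomputable def rootBetween (n : ℕ) (A C : ℤ) : Fin (n + 1) → ℤ :=
  cum (fun p => simpleRoot (fold n p)) C - cum (fun p => simpleRoot (fold n p)) A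

/-- Telescoping: an additive function needs only an antiderivative `H` of its values along the walk.
Height, coroot pairing, invariant form, rank and defect are all computed this way. -/
theorem map_rootBetween {M : Type*} [AddCommGroup M] (f : (Fin (n + 1) → ℤ) →+ M) {H : ℤ → M}
    (h : ∀ p, f (simpleRoot (fold n p)) = H (p + 1) - H p) (A C : ℤ) :
    f (rootBetween n A C) = H C - H A := by
  have h1 := sub_eq_cum_sub_cum (H := fun x => f (cum (fun p => simpleRoot (fold n p)) x))
    (g := fun p => f (simpleRoot (fold n p))) (fun x => by simp only [cum_succ, map_add]) A C
  have h2 := sub_eq_cum_sub_cum (H := H) (g := fun p => f (simpleRoot (fold n p)))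
    (fun x => by rw [h]; abel) A C
  rw [rootBetween, map_sub, h2]
  exact h1

theorem rootBetween_add (A B C : ℤ) :
    rootBetween n A B + rootBetween n B C = rootBetween n A C := by
  simp only [rootBetween]; abel

theorem rootBetween_succ (A : ℤ) : rootBetween n A (A + 1) = simpleRoot (fold n A) := by
  simp [rootBetween, cum_succ]

theorem rootBetween_self (A : ℤ) : rootBetween n A A = 0 := by simp [rootBetween]

theorem rootBetween_swap (A C : ℤ) : rootBetween n A C = -rootBetween n C A := by
  simp [rootBetween]

theorem rootBetween_add_one_right (A C : ℤ) :
    rootBetween n A (C + 1) = rootBetween n A C + simpleRoot (fold n C) := by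
  rw [← rootBetween_add A C, rootBetween_succ]

theorem rootBetween_reflect (A C : ℤ) :
    rootBetween n (1 - C) (1 - A) = rootBetween n A C := by
  have h := sub_eq_cum_sub_cum
    (H := fun x => -cum (fun p => simpleRoot (fold n p)) (1 - x))
    (g := fun p => simpleRoot (fold n p)) (fun x => by
      have := cum_succ (fun p => simpleRoot (fold n p)) (-x)
      rw [show 1 - (x + 1) = -x by ring, show 1 - x = -x + 1 by ring, this, fold_neg]
      abel) A C
  rw [rootBetween, rootBetween, ← h]
  abel

/-- The total height of a vector. -/
def height : (Fin (n + 1) → ℤ) →+ ℤ where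
  toFun X := ∑ i, X i
  map_zero' := by simp
  map_add' X Y := by simp [Finset.sum_add_distrib]

theorem height_rootBetween (A C : ℤ) : height (rootBetween n A C) = C - A :=
  map_rootBetween height (H := id) (fun p => by simp [height, simpleRoot]) A C

theorem rootBetween_nonneg {A C : ℤ} (h : A ≤ C) (i : Fin (n + 1)) :
    0 ≤ rootBetween n A C i := by
  induction C, h using Int.leInduction with
  | base => simp [rootBetween_self]
  | succ C h ih =>
    rw [rootBetween_add_one_right, Pi.add_apply]
    refine add_nonneg ih ?_
    simp only [simpleRoot, Pi.single_apply]
    split_ifs <;> omega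

theorem le_of_rootBetween_nonneg {A C : ℤ} (h : ∀ i, 0 ≤ rootBetween n A C i) : A ≤ C := by
  have := height_rootBetween (n := n) A C
  have h2 : 0 ≤ height (rootBetween n A C) := by
    simpa only [height, AddMonoidHom.coe_mk, ZeroHom.coe_mk] using
      Finset.sum_nonneg fun i _ => h i
  omega

/-! ### The Weyl group action and the invariant form -/

/-- Pairing with the simple coroot `αᵢ^∨`. -/
def pairing (i : Fin (n + 1)) : (Fin (n + 1) → ℤ) →+ ℤ where
  toFun X := ∑ j, cartan n i j * X j
  map_zero' := by simp
  map_add' X Y := by simp [mul_add, Finset.sum_add_distrib]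

/-- The contribution of the endpoint `A` to the pairing of `αᵢ^∨` with `rootBetween n A C`. -/
def kappa (i : Fin (n + 1)) (A : ℤ) : ℤ :=
  (if fold n A = i then 1 else 0) - if fold n (A - 1) = i then 1 else 0

theorem isEnd_iff_int (i : Fin (n + 1)) : IsEnd i ↔ (i.val : ℤ) = 0 ∨ (i.val : ℤ) = n := by
  rw [IsEnd, Fin.ext_iff, Fin.ext_iff, Fin.val_zero, Fin.val_last]
  omega

/-- The possible values of `fold` at three consecutive integers. -/
theorem fold_neighbours (hn : 0 < n) (p : ℤ) :
    let x : ℤ := (fold n p).val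
    let y : ℤ := (fold n (p - 1)).val
    let z : ℤ := (fold n (p + 1)).val
    (x = 0 ∧ y = 1 ∧ z = 1) ∨ (x = n ∧ y = n - 1 ∧ z = n - 1) ∨
      (0 < x ∧ x < n ∧ (y = x - 1 ∧ z = x + 1 ∨ y = x + 1 ∧ z = x - 1)) := by
  obtain ⟨q, r, rfl, h0, h1⟩ := exists_two_mul_add hn p
  intro x y z
  have hx := fold_val q h0.le (by omega : r ≤ 2 * n)
  have hy := fold_val q (by omega : -(n : ℤ) ≤ r - 1) (by omega)
  have hz := fold_val q (by omega : -(n : ℤ) ≤ r + 1) (by omega)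
  rw [← add_sub_assoc] at hy
  rw [← add_assoc] at hz
  change x = _ at hx
  change y = _ at hy
  change z = _ at hz
  split_ifs at hx hy hz <;> omega

theorem fold_add_one_ne (hn : 0 < n) (p : ℤ) : fold n (p + 1) ≠ fold n p := by
  have h := fold_neighbours hn p
  rw [Ne, Fin.ext_iff]
  simp only at h
  omega

theorem fold_sub_one_ne (hn : 0 < n) (p : ℤ) : fold n (p - 1) ≠ fold n p := by
  have h := fold_add_one_ne hn (p - 1)
  rw [sub_add_cancel] at h
  exact h.symm

/-- The Cartan matrix is minus a discrete Laplacian along the walk: `2` at `fold n p` and `-1` for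
each neighbour. At an end vertex the two neighbours coincide, which produces the entry `-2`. -/
theorem cartan_fold (hn : 0 < n) (i : Fin (n + 1)) (p : ℤ) :
    cartan n i (fold n p) = kappa i p - kappa i (p + 1) := by
  have h := fold_neighbours hn p
  have hi := i.isLt
  simp only [cartan, kappa, add_sub_cancel_right, Fin.ext_iff, isEnd_iff_int]
  simp only at h
  generalize (fold n p).val = x at *
  generalize (fold n (p - 1)).val = y at *
  generalize (fold n (p + 1)).val = z at *
  split_ifs <;> omega

theorem pairing_simpleRoot (i j : Fin (n + 1)) : pairing i (simpleRoot j) = cartan n i j := by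
  simp [pairing, simpleRoot, Pi.single_apply]

theorem pairing_rootBetween (hn : 0 < n) (i : Fin (n + 1)) (A C : ℤ) :
    pairing i (rootBetween n A C) = kappa i A - kappa i C := by
  rw [map_rootBetween (pairing i) (H := fun p => -kappa i p) (fun p => by
    rw [pairing_simpleRoot, cartan_fold hn]; ring)]
  ring

theorem kappa_smul_simpleRoot (hn : 0 < n) (i : Fin (n + 1)) (A : ℤ) :
    kappa i A • simpleRoot i = rootBetween n A (A + kappa i A) := by
  unfold kappa
  split_ifs with h1 h2 h2
  · exact absurd (h2.trans h1.symm) (fold_sub_one_ne hn A)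
  · simp [rootBetween_succ, h1]
  · have := rootBetween_succ (n := n) (A - 1)
    rw [sub_add_cancel, h2] at this
    rw [rootBetween_swap, zero_sub, ← sub_eq_add_neg, this]
    simp
  · simp [rootBetween_self]

/-- The pairing with the coroot is a difference of endpoint terms, and each term times `αᵢ` is what
is gained or lost by moving that endpoint by at most one. -/
theorem reflect_rootBetween (hn : 0 < n) (i : Fin (n + 1)) (A C : ℤ) :
    reflect i (rootBetween n A C) = rootBetween n (A + kappa i A) (C + kappa i C) := by
  have h : reflect i (rootBetween n A C) =
      rootBetween n A C - pairing i (rootBetween n A C) • simpleRoot i := rfl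
  rw [h, pairing_rootBetween hn, sub_smul, kappa_smul_simpleRoot hn, kappa_smul_simpleRoot hn]
  simp only [rootBetween]
  abel

theorem kappa_add_mul (i : Fin (n + 1)) (A q : ℤ) : kappa i (A + 2 * n * q) = kappa i A := by
  unfold kappa
  rw [fold_add_mul, show A + 2 * n * q - 1 = (A - 1) + 2 * n * q by ring, fold_add_mul]

/-- The endpoint move `A ↦ A + kappa i A` swaps `A` and `A + 1` whenever `fold n A = i`, so it is an
involution. -/
theorem kappa_add_kappa (hn : 0 < n) (i : Fin (n + 1)) (A : ℤ) :
    kappa i (A + kappa i A) = -kappa i A := by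
  by_cases h1 : fold n A = i
  · have h2 : fold n (A - 1) ≠ i := h1 ▸ fold_sub_one_ne hn A
    have h3 : fold n (A + 1) ≠ i := h1 ▸ fold_add_one_ne hn A
    simp [kappa, h1, h2, h3]
  · by_cases h2 : fold n (A - 1) = i
    · have h3 : fold n (A - 1 - 1) ≠ i := h2 ▸ fold_sub_one_ne hn (A - 1)
      simp [kappa, h1, h2, h3, ← sub_eq_add_neg]
    · simp [kappa, h1, h2]

theorem IsRealRoot.exists_rootBetween (hn : 0 < n) {α : Fin (n + 1) → ℤ} (h : IsRealRoot α) :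
    ∃ A C, ¬ (2 * n : ℤ) ∣ C - A ∧ α = rootBetween n A C := by
  induction h with
  | simple i =>
    refine ⟨i, i + 1, ?_, by rw [rootBetween_succ, fold_coe]⟩
    rw [add_sub_cancel_left]
    rintro ⟨c, hc⟩
    rw [mul_assoc] at hc
    omega
  | reflect i h ih =>
    obtain ⟨A, C, hAC, rfl⟩ := ih
    refine ⟨_, _, ?_, reflect_rootBetween hn i A C⟩
    -- The move is an involution commuting with translation by `2 * n`, so congruent images come
    -- from congruent endpoints.
    rintro ⟨q, hq⟩
    refine hAC ⟨q, ?_⟩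
    have hC : C + kappa i C = A + kappa i A + 2 * n * q := by linear_combination hq
    have h1 := kappa_add_kappa hn i C
    rw [hC, kappa_add_mul, kappa_add_kappa hn] at h1
    linear_combination hq - h1

/-- The pairing of the endpoints of two sums of consecutive simple roots. -/
def endPairing (n : ℕ) (p q : ℤ) : ℤ :=
  (if (2 * n : ℤ) ∣ p - q then 1 else 0) - if (2 * n : ℤ) ∣ p + q - 1 then 1 else 0

/-- The two congruences `q ≡ p` and `q ≡ -p` describe the fibre of `fold`; they coincide exactly at
the end vertices, where the symmetrizer is `2`. -/
theorem symmetrizer_mul_ite (hn : 0 < n) (p q : ℤ) :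
    symmetrizer n (fold n p) * (if fold n q = fold n p then 1 else 0) =
      (if (2 * n : ℤ) ∣ p - q then 1 else 0) + if (2 * n : ℤ) ∣ p + q then 1 else 0 := by
  have h0 : fold n q = fold n p ↔ _ := eq_comm.trans (fold_eq_fold_iff hn p q)
  simp only [symmetrizer, h0, isEnd_fold_iff hn]
  have h1 : (2 * n : ℤ) ∣ p - q → (2 * n : ℤ) ∣ p + q → (n : ℤ) ∣ p := by
    intro h1 h2
    have := dvd_add h1 h2
    rw [show p - q + (p + q) = 2 * p by ring] at this
    exact (mul_dvd_mul_iff_left two_ne_zero).1 this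
  have h2 : (n : ℤ) ∣ p → ((2 * n : ℤ) ∣ p - q ↔ (2 * n : ℤ) ∣ p + q) := by
    rintro ⟨c, rfl⟩
    constructor
    · rintro ⟨d, hd⟩
      exact ⟨c - d, by linear_combination -hd⟩
    · rintro ⟨d, hd⟩
      exact ⟨c - d, by linear_combination -hd⟩
  split_ifs <;> tauto

/-- This makes `endPairing` an antiderivative in its first argument, up to sign, so that the form
telescopes. -/
theorem symmetrizer_mul_kappa (hn : 0 < n) (p q : ℤ) :
    symmetrizer n (fold n p) * kappa (fold n p) q =
      endPairing n p q - endPairing n (p + 1) q := by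
  have h1 : p - (q - 1) = p + 1 - q := by ring
  have h2 : p + 1 + q - 1 = p + q := by ring
  rw [kappa, mul_sub, symmetrizer_mul_ite hn, symmetrizer_mul_ite hn, endPairing, endPairing, h1,
    h2, ← add_sub_assoc]
  ring

/-- The form with Gram matrix `D C`, as a function of its first argument. -/
def form (Y : Fin (n + 1) → ℤ) : (Fin (n + 1) → ℤ) →+ ℤ where
  toFun X := ∑ i, X i * (symmetrizer n i * pairing i Y)
  map_zero' := by simp
  map_add' X X' := by simp [add_mul, Finset.sum_add_distrib]

theorem sqLength_eq_form (X : Fin (n + 1) → ℤ) : sqLength X = form X X := by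
  simp only [sqLength, form, pairing, AddMonoidHom.coe_mk, ZeroHom.coe_mk, Finset.mul_sum]
  refine Finset.sum_congr rfl fun i _ => Finset.sum_congr rfl fun j _ => by ring

theorem form_rootBetween (hn : 0 < n) (A C A' C' : ℤ) :
    form (rootBetween n A' C') (rootBetween n A C) =
      endPairing n A A' - endPairing n C A' - endPairing n A C' + endPairing n C C' := by
  rw [map_rootBetween _ (H := fun p => endPairing n p C' - endPairing n p A') (fun p => by
    simp only [form, AddMonoidHom.coe_mk, ZeroHom.coe_mk, simpleRoot, Pi.single_apply, ite_mul,
      one_mul, zero_mul, Finset.sum_ite_eq', Finset.mem_univ, if_true]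
    rw [pairing_rootBetween hn, mul_sub, symmetrizer_mul_kappa hn, symmetrizer_mul_kappa hn]
    ring)]
  ring

theorem two_mul_not_dvd_odd (m : ℤ) : ¬ (2 * n : ℤ) ∣ 2 * m + 1 := by
  rintro ⟨c, hc⟩
  rw [mul_assoc] at hc
  omega

theorem endPairing_self (p : ℤ) : endPairing n p p = 1 := by
  have h := two_mul_not_dvd_odd (n := n) (p - 1)
  -- The second indicator of `endPairing` vanishes by parity.
  rw [show 2 * (p - 1) + 1 = p + p - 1 by ring] at h
  simp [endPairing, h]

theorem endPairing_comm (p q : ℤ) : endPairing n p q = endPairing n q p := by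
  rw [endPairing, endPairing, add_comm p q, if_congr (dvd_sub_comm (a := (2 * n : ℤ))) rfl rfl]

theorem endPairing_reflect (p q : ℤ) : endPairing n p (1 - q) = -endPairing n p q := by
  unfold endPairing
  rw [show p - (1 - q) = p + q - 1 by ring, show p + (1 - q) - 1 = p - q by ring]
  ring

theorem sqLength_rootBetween (hn : 0 < n) (A C : ℤ) :
    sqLength (rootBetween n A C) = 2 - 2 * endPairing n A C := by
  rw [sqLength_eq_form, form_rootBetween hn, endPairing_self, endPairing_self,
    endPairing_comm C A]
  ring

theorem endPairing_eq_neg_one_iff (p q : ℤ) :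
    endPairing n p q = -1 ↔ (2 * n : ℤ) ∣ p + q - 1 := by
  unfold endPairing
  have h : (2 * n : ℤ) ∣ p - q → ¬ (2 * n : ℤ) ∣ p + q - 1 := by
    intro h1 h2
    have := dvd_add h1 h2
    rw [show p - q + (p + q - 1) = 2 * (p - 1) + 1 by ring] at this
    exact two_mul_not_dvd_odd _ this
  split_ifs <;> tauto

theorem neg_one_le_endPairing (p q : ℤ) : -1 ≤ endPairing n p q := by
  unfold endPairing
  split_ifs <;> omega

theorem endPairing_pos_iff (p q : ℤ) : 0 < endPairing n p q ↔ (2 * n : ℤ) ∣ p - q := by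
  constructor
  · unfold endPairing
    split_ifs <;> simp_all
  · intro h
    have h1 : ¬ (2 * n : ℤ) ∣ p + q - 1 := by
      rw [← endPairing_eq_neg_one_iff]
      unfold endPairing
      rw [if_pos h]
      split_ifs <;> omega
    simp [endPairing, h, h1]

/-- The squared length is `2 - 2 * endPairing n A C ≤ 4`, and the simple root at vertex `0` attains
`4`. -/
theorem isLongRoot_rootBetween_iff (hn : 0 < n) {A C : ℤ} (h : IsRealRoot (rootBetween n A C)) :
    IsLongRoot (rootBetween n A C) ↔ (2 * n : ℤ) ∣ A + C - 1 := by
  rw [← endPairing_eq_neg_one_iff]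
  constructor
  · rintro ⟨-, hmax⟩
    have h1 := hmax _ (.simple (fold n 0))
    have h2 := neg_one_le_endPairing (n := n) A C
    have h3 : endPairing n 0 (0 + 1) = -1 := by
      rw [endPairing_eq_neg_one_iff]; simp
    rw [← rootBetween_succ, sqLength_rootBetween hn, sqLength_rootBetween hn, h3] at h1
    omega
  · refine fun h1 => ⟨h, fun β hβ => ?_⟩
    obtain ⟨A', C', -, rfl⟩ := hβ.exists_rootBetween hn
    have h2 := neg_one_le_endPairing (n := n) A' C'
    rw [sqLength_rootBetween hn, sqLength_rootBetween hn, h1]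
    omega

/-- Symmetric walks have real roots as rank vectors. -/
theorem isRealRoot_rootBetween_of_dvd (hn : 0 < n) {A C : ℤ} (h : A < C)
    (hd : (2 * n : ℤ) ∣ A + C - 1) : IsRealRoot (rootBetween n A C) := by
  obtain ⟨q, hq⟩ := hd
  have hA : A = 1 - C + 2 * n * q := by linear_combination hq
  have hC : n * q + 1 ≤ C := by rw [mul_assoc] at hA; omega
  rw [hA]
  clear hq hA h
  -- The sum is symmetric about the end vertex at `n * q`. Reflecting in the next vertex `fold n m`
  -- lengthens it by one at both ends.
  induction C, hC using Int.leInduction with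
  | base =>
    rw [show 1 - (n * q + 1) + 2 * n * q = (n * q : ℤ) by ring, rootBetween_succ]
    exact .simple _
  | succ m hm ih =>
    have h1 : kappa (fold n m) m = 1 := by
      simp [kappa, fold_sub_one_ne hn m]
    have h2 : kappa (fold n m) (1 - m + 2 * n * q) = -1 := by
      rw [kappa_add_mul, kappa, ← fold_neg, neg_sub, sub_sub_cancel_left, fold_neg]
      simp [fold_sub_one_ne hn m]
    have := IsRealRoot.reflect (fold n m) ih
    rw [reflect_rootBetween hn, h1, h2] at this
    convert this using 2
    ring

/-- A real root determines its walk up to translation and inversion. -/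
theorem rootBetween_injective (hn : 0 < n) {A C A' C' : ℤ} (hAC : ¬ (2 * n : ℤ) ∣ C - A)
    (h : rootBetween n A C = rootBetween n A' C') :
    (∃ q, A' = A + 2 * n * q ∧ C' = C + 2 * n * q) ∨
      ∃ q, A' = 1 - C + 2 * n * q ∧ C' = 1 - A + 2 * n * q := by
  -- Since `endPairing` is odd under `q ↦ 1 - q`, testing against `rootBetween n p (1 - p)` gives
  -- twice the wanted identity.
  have key : ∀ p, endPairing n A p - endPairing n C p =
      endPairing n A' p - endPairing n C' p := by
    intro p
    have := congrArg (form (rootBetween n p (1 - p))) h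
    simp only [form_rootBetween hn, endPairing_reflect] at this
    omega
  have hh : C - A = C' - A' := by rw [← height_rootBetween (n := n), h, height_rootBetween]
  -- At `p = A` the left side of `key` is then at least `1`, so `A' ≡ A` or `A + C' ≡ 1` modulo `2 *
  -- n`; equal heights fix the other endpoint.
  have hAC' : endPairing n C A ≤ 0 := by
    rw [← not_lt, endPairing_pos_iff]; exact hAC
  have h1 := key A
  rw [endPairing_self] at h1
  have h2 : 0 < endPairing n A' A ∨ endPairing n C' A < 0 := by omega
  rcases h2 with h2 | h2
  · left
    rw [endPairing_pos_iff] at h2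
    obtain ⟨q, hq⟩ := h2
    exact ⟨q, by omega, by omega⟩
  · right
    have h3 := (endPairing_eq_neg_one_iff (n := n) C' A).1 (by
      have := neg_one_le_endPairing (n := n) C' A; omega)
    obtain ⟨q, hq⟩ := h3
    exact ⟨q, by omega, by omega⟩

/-! ### The defect -/

/-- The defect as an additive map. -/
def defectHom (ω : Fin n → Bool) : (Fin (n + 1) → ℤ) →+ ℤ where
  toFun := defect ω
  map_zero' := by simp [defect]
  map_add' X Y := by simp [defect, add_mul, Finset.sum_add_distrib]

/-! ### Strings as walks in the universal cover -/

/-- `w` is a string which lifts to the walk from `a` to `b` in the universal cover of the cycle of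
places. -/
structure Walks (ω : Fin n → Bool) (w : Word n (Letter n)) (a b : ℤ) : Prop where
  isString : IsString ω w
  start : w.start ω = pos n a
  length : (w.length : ℤ) = b - a

theorem Walks.finish (hn : 0 < n) {w : Word n (Letter n)} {a b : ℤ} (h : Walks ω w a b) :
    w.finish ω = pos n b := by
  rw [h.isString.finish_eq hn, h.start, next_iterate_pos, h.length]
  congr 1; ring

theorem Walks.mul (hn : 0 < n) {v w : Word n (Letter n)} {a b c : ℤ} (hv : Walks ω v a b)
    (hw : Walks ω w b c) : Walks ω (v.mul w) a c := by
  have h : v.finish ω = w.start ω := by rw [hv.finish hn, hw.start]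
  refine ⟨hv.isString.mul hn hw.isString h, ?_, ?_⟩
  · rw [Word.start_mul hv.isString h, hv.start]
  · rw [Word.length_mul]
    push_cast
    rw [hv.length, hw.length]
    ring

theorem Walks.inv (hn : 0 < n) {w : Word n (Letter n)} {a b : ℤ} (h : Walks ω w a b) :
    Walks ω w.inv (-1 - b) (-1 - a) := by
  refine ⟨h.isString.inv hn, ?_, ?_⟩
  · rw [h.isString.start_inv, h.finish hn, flip_pos]
  · rw [Word.length_inv, h.length]; ring

/-- `w` is a locally free string which runs through the vertices `fold A, …, fold B`, with a loop
at each visit of `0` or `n`. -/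
def Spans (ω : Fin n → Bool) (w : Word n (Letter n)) (A B : ℤ) : Prop :=
  Walks ω w (lift n (A - 1) + 1) (lift n B)

theorem Spans.le {w : Word n (Letter n)} {A B : ℤ} (h : Spans ω w A B) : A ≤ B := by
  have h1 := Walks.length h
  have h2 : lift n (A - 1) < lift n B := by omega
  rw [lift_lt_lift_iff] at h2
  omega

theorem Spans.inv (hn : 0 < n) {w : Word n (Letter n)} {A B : ℤ} (h : Spans ω w A B) :
    Spans ω w.inv (-B) (-A) := by
  have h1 := Walks.inv hn h
  have h2 : lift n (-B - 1) + 1 = -1 - lift n B := by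
    rw [show -B - 1 = -(B + 1) by ring, lift_neg hn]
    ring_nf
  have h3 : lift n (-A) = -1 - (lift n (A - 1) + 1) := by rw [lift_neg hn]; ring
  rw [Spans, h2, h3]
  exact h1

theorem Spans.mem_lfStrings (hn : 0 < n) {w : Word n (Letter n)} {A B : ℤ}
    (h : Spans ω w A B) : w ∈ lfStrings ω := by
  refine ⟨h.isString, (isLocallyFree_iff hn h.isString).2 ⟨?_, ?_⟩⟩
  · have h1 := (h.inv hn).finish hn
    rw [h.isString.finish_inv hn] at h1
    rw [h1, not_atLoop_pos_iff hn]
    exact ⟨_, rfl⟩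
  · rw [h.finish hn, not_atLoop_pos_iff hn]
    exact ⟨_, rfl⟩

/-- Local freeness says that the end and the reversed start avoid loop places, hence are in the
image of `lift`. -/
theorem exists_spans (hn : 0 < n) {w : Word n (Letter n)} (h : w ∈ lfStrings ω) :
    ∃ A B, Spans ω w A B := by
  obtain ⟨hs, hlf⟩ := h
  obtain ⟨a, ha⟩ := exists_pos_eq (w.start ω)
  have hw : Walks ω w a (a + w.length) := ⟨hs, ha.symm, by ring⟩
  obtain ⟨h1, h2⟩ := (isLocallyFree_iff hn hs).1 hlf
  rw [hw.finish hn, not_atLoop_pos_iff hn] at h2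
  rw [← ha, flip_pos, not_atLoop_pos_iff hn] at h1
  obtain ⟨A, hA⟩ := h1
  obtain ⟨B, hB⟩ := h2
  refine ⟨-A, B, ?_⟩
  have h3 : lift n (-A - 1) + 1 = a := by
    rw [show -A - 1 = -(A + 1) by ring, lift_neg hn, add_sub_cancel_right, ← hA]
    ring
  rw [Spans, h3, ← hB]
  exact hw

/-- Start and length determine the class; translation by the period `2 * n + 2` of the cover becomes
translation by `2 * n` after contracting loops. -/
theorem Spans.toStar_eq_iff (hn : 0 < n) {v w : Word n (Letter n)} {A B A' B' : ℤ}
    (hv : Spans ω v A B) (hw : Spans ω w A' B') :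
    v.toStar = w.toStar ↔ ∃ q, A' = A + 2 * n * q ∧ B' = B + 2 * n * q := by
  have h1 := Walks.length hv
  have h2 := Walks.length hw
  rw [CTilde.toStar_eq_iff hn hv.isString hw.isString, Walks.start hv, Walks.start hw, eq_comm,
    pos_eq_pos_iff]
  constructor
  · rintro ⟨⟨q, hq⟩, hl⟩
    refine ⟨q, ?_, ?_⟩
    · have : lift n (A' - 1) = lift n (A - 1 + 2 * n * q) := by
        rw [lift_add_mul hn]; linear_combination hq
      linear_combination lift_injective this
    · apply lift_injective
      rw [lift_add_mul hn]
      zify at hl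
      linear_combination hq + h1 - h2 - hl
  · rintro ⟨q, rfl, rfl⟩
    have h3 : A + 2 * n * q - 1 = A - 1 + 2 * n * q := by ring
    rw [h3, lift_add_mul hn] at h2 ⊢
    rw [lift_add_mul hn] at h2
    refine ⟨⟨q, by ring⟩, ?_⟩
    zify
    linear_combination h1 - h2

theorem Spans.of_toStar_eq (hn : 0 < n) {v w : Word n (Letter n)} {A B : ℤ} (hw : Spans ω w A B)
    (hv : IsString ω v) (h : v.toStar = w.toStar) : Spans ω v A B := by
  rw [CTilde.toStar_eq_iff hn hv hw.isString] at h
  exact ⟨hv, h.1.trans hw.start, by rw [h.2, Walks.length hw]⟩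

theorem Spans.simClass_eq (hn : 0 < n) {w : Word n (Letter n)} {A B : ℤ} (hw : Spans ω w A B) :
    simClass ω w = {v | Spans ω v A B} := by
  ext v
  constructor
  · exact fun h => hw.of_toStar_eq hn h.1 h.2
  · exact fun h => ⟨h.isString, (h.toStar_eq_iff hn hw).2 ⟨0, by simp, by simp⟩⟩

theorem Spans.translate (hn : 0 < n) {w : Word n (Letter n)} {A B : ℤ} (h : Spans ω w A B)
    (q : ℤ) : Spans ω w (A + 2 * n * q) (B + 2 * n * q) := by
  rw [Spans, show A + 2 * n * q - 1 = A - 1 + 2 * n * q by ring, lift_add_mul hn, lift_add_mul hn]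
  refine ⟨h.isString, ?_, ?_⟩
  · rw [Walks.start h, pos_eq_pos_iff]
    exact ⟨-q, by ring⟩
  · rw [Walks.length h]; ring

/-! ### The rank vector -/

theorem count_vertices (hn : 0 < n) {w : Word n (Letter n)} {a b : ℤ} (h : Walks ω w a b)
    (i : Fin (n + 1)) : (((w.vertices ω).count i : ℕ) : ℤ) =
      cum (fun p => if (pos n p).1 = i then 1 else 0) (b + 1) -
        cum (fun p => if (pos n p).1 = i then 1 else 0) a := by
  have key : ∀ m : ℕ, ((((List.range m).map fun j : ℕ => (pos n (a + j)).1).count i : ℕ) : ℤ) =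
      cum (fun p => if (pos n p).1 = i then 1 else 0) (a + m) -
        cum (fun p => if (pos n p).1 = i then 1 else 0) a := by
    intro m
    induction m with
    | zero => simp
    | succ m ih =>
      rw [List.range_succ, List.map_append, List.count_append]
      push_cast
      rw [ih, ← add_assoc, cum_succ]
      simp only [List.map_cons, List.map_nil, List.count_singleton, beq_iff_eq]
      push_cast
      ring
  have hb : b + 1 = a + (w.length + 1 : ℕ) := by
    push_cast; rw [h.length]; ring
  rw [vertices_eq hn h.isString, hb, ← key, h.start]
  simp only [next_iterate_pos]

theorem Spans.rk_eq (hn : 0 < n) {w : Word n (Letter n)} {A B : ℤ} (h : Spans ω w A B) :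
    rk ω w = rootBetween n A (B + 1) := by
  -- An end vertex occupies two positions, before and after its loop, so the count there is doubled;
  -- the division by `2` in `rk` is exact.
  have hsymm : ∀ i, (((w.vertices ω).count i : ℕ) : ℤ) =
      (if IsEnd i then 2 else 1) * rootBetween n A (B + 1) i := by
    intro i
    rw [count_vertices hn h]
    have h1 := map_rootBetween (n := n) (M := ℤ)
      ((if IsEnd i then (2 : ℤ) else 1) • (Pi.evalAddMonoidHom (fun _ => ℤ) i))
      (H := fun p => cum (fun p => if (pos n p).1 = i then 1 else 0) (lift n (p - 1) + 1))
      (fun p => by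
        simp only [add_sub_cancel_right]
        have h2 := lift_add_one hn (p - 1)
        rw [sub_add_cancel] at h2
        have h3 := pos_lift_fst hn p
        have h4 := pos_lift_add_one_fst hn (p - 1)
        rw [sub_add_cancel] at h4
        by_cases hp : IsEnd (fold n p)
        · rw [if_pos hp] at h2
          have h5 : lift n p = lift n (p - 1) + 1 + 1 := by rw [h2]; ring
          rw [cum_succ, h3, h5, cum_succ, h4]
          by_cases hi : fold n p = i
          · subst hi
            simp [simpleRoot, hp]; ring
          · simp [simpleRoot, hi, Ne.symm hi, -ite_smul]
        · rw [if_neg hp] at h2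
          rw [cum_succ, h3, h2]
          by_cases hi : fold n p = i
          · subst hi
            simp [simpleRoot, hp]
          · simp [simpleRoot, hi, Ne.symm hi, -ite_smul]) A (B + 1)
    simp only [add_sub_cancel_right] at h1
    rw [← h1]
    simp [-ite_smul]
  ext i
  unfold rk
  have := hsymm i
  split_ifs at this ⊢ with hi
  · omega
  · rw [this, one_mul]

/-! ### Counting steps -/

/-- The number of direct (`t = true`) or inverse (`t = false`) steps between `0` and `x`. -/
noncomputable def stepCount (ω : Fin n → Bool) (t : Bool) : ℤ → ℤ :=
  cum fun x => if isDirectStep ω x = t then 1 else 0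

variable {t : Bool}

theorem stepCount_succ (x : ℤ) :
    stepCount ω t (x + 1) = stepCount ω t x + if isDirectStep ω x = t then 1 else 0 :=
  cum_succ _ _

theorem stepCount_mono : Monotone (stepCount ω t) := by
  refine monotone_int_of_le_succ fun x => ?_
  rw [stepCount_succ]
  split_ifs <;> omega

theorem stepCount_lt {x y : ℤ} (hx : isDirectStep ω x = t) (h : x < y) :
    stepCount ω t x < stepCount ω t y := by
  have h1 := stepCount_mono (ω := ω) (t := t) (show x + 1 ≤ y by omega)
  rw [stepCount_succ, if_pos hx] at h1
  omega

theorem stepCount_inj {x y : ℤ} (hx : isDirectStep ω x = t) (hy : isDirectStep ω y = t)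
    (h : stepCount ω t x = stepCount ω t y) : x = y := by
  rcases lt_trichotomy x y with hxy | hxy | hxy
  · have := stepCount_lt hx hxy; omega
  · exact hxy
  · have := stepCount_lt hy hxy; omega

/-- Of the steps `x` and `-1 - x` exactly one has type `t`, so the left side grows by one with `x`.
-/
theorem stepCount_sub_neg (hn : 0 < n) (x : ℤ) :
    stepCount ω t x - stepCount ω t (-x) = x := by
  have := eq_of_succ_eq (f := fun x => stepCount ω t x - stepCount ω t (-x) - x) (fun x => by
    have h1 := stepCount_succ (ω := ω) (t := t) x
    have h2 := stepCount_succ (ω := ω) (t := t) (-(x + 1))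
    rw [show -(x + 1) + 1 = -x by ring, show -(x + 1) = -1 - x by ring,
      isDirectStep_neg hn] at h2
    rw [show -(x + 1) = -1 - x by ring, h1, h2]
    cases h : isDirectStep ω x <;> cases t <;> simp <;> ring_nf) x 0
  rw [neg_zero, sub_self, sub_zero] at this
  omega

theorem stepCount_add_mul (hn : 0 < n) (x q : ℤ) :
    stepCount ω t (x + 2 * n * q) = stepCount ω t x + n * q := by
  -- The difference does not depend on the point; at `-(n * q)` the two arguments are opposite and
  -- `stepCount_sub_neg` applies.
  have := eq_of_succ_eq (f := fun x => stepCount ω t (x + 2 * n * q) - stepCount ω t x)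
    (fun x => by
      rw [add_right_comm, stepCount_succ, stepCount_succ, isDirectStep_add_mul hn]
      ring) x (-(n * q))
  rw [show -(n * q : ℤ) + 2 * n * q = n * q by ring, stepCount_sub_neg hn] at this
  linear_combination this

/-- The first direct, or inverse, step from `x` on. -/
theorem exists_next_step (hn : 0 < n) (ω : Fin n → Bool) (t : Bool) (x : ℤ) :
    ∃ B, x ≤ B ∧ isDirectStep ω B = t ∧ (∀ C, x ≤ C → C < B → isDirectStep ω C = !t) ∧
      stepCount ω t B = stepCount ω t x := by
  have hex : ∃ B, x ≤ B ∧ isDirectStep ω B = t := by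
    by_cases h : isDirectStep ω x = t
    · exact ⟨x, le_rfl, h⟩
    -- The reversed step has the other type; the translation moves it beyond `x`.
    · refine ⟨-1 - x + 2 * n * (|x| + 1), ?_, ?_⟩
      · have h1 : (|x| + 1) * 1 ≤ (|x| + 1) * n :=
          mul_le_mul_of_nonneg_left (by omega) (by positivity)
        have h2 := le_abs_self x
        nlinarith
      · rw [isDirectStep_add_mul hn, isDirectStep_neg hn]
        cases h' : isDirectStep ω x <;> cases t <;> simp_all
  obtain ⟨B, ⟨h1, h2⟩, h3⟩ := Int.exists_least_of_bdd (P := fun B => x ≤ B ∧ isDirectStep ω B = t)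
    ⟨x, fun z hz => hz.1⟩ hex
  have h4 : ∀ C, x ≤ C → C < B → isDirectStep ω C = !t := by
    intro C hC hCB
    by_contra h
    have := h3 C ⟨hC, by cases h' : isDirectStep ω C <;> cases t <;> simp_all⟩
    omega
  refine ⟨B, h1, h2, h4, ?_⟩
  have key : ∀ y, x ≤ y → y ≤ B → stepCount ω t y = stepCount ω t x := by
    intro y hy
    induction y, hy using Int.leInduction with
    | base => exact fun _ => rfl
    | succ y hy ih =>
      intro hyB
      rw [stepCount_succ, ih (by omega), h4 y hy (by omega)]
      cases t <;> simp
  exact key B h1 le_rfl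

/-! ### Longest direct and inverse strings -/

/-- Loops can take the exponent that purity demands, so only an η-step of the wrong type stops a
pure string. The second half covers every longest string, because `longest` is an arbitrary choice.
-/
theorem walks_longest_of_start (hn : 0 < n) {Q : Word n (Letter n) → Prop} {d : Bool} {a B : ℤ}
    (hQ : ∀ v, Q v ↔ (IsString ω v ∧ IsPure d v) ∧ v.start ω = pos n a)
    (haB : a ≤ lift n B) (hB : isDirectStep ω B = !d)
    (hC : ∀ C, a ≤ lift n C → C < B → isDirectStep ω C = d) :
    (∃ v, IsLongest Q v) ∧ ∀ v, IsLongest Q v → Walks ω v a (lift n B) := by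
  obtain ⟨m, hm⟩ : ∃ m : ℕ, lift n B = a + m := ⟨(lift n B - a).toNat, by omega⟩
  have hbound : ∀ v, Q v → v.length ≤ m := by
    intro v hv
    obtain ⟨⟨h1, h2⟩, h3⟩ := (hQ v).1 hv
    by_contra! hlt
    have h4 := h2.step_direct hn h1 hlt
    rw [h3, next_iterate_pos, ← hm, step_pos_lift_direct hn, hB] at h4
    simp at h4
  have hex : Q (walk ω (pos n a) m d) := by
    refine (hQ _).2 ⟨⟨isString_walk hn _ _ _, isPure_walk fun j hj => ?_⟩, start_walk _ _ _⟩
    rw [next_iterate_pos]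
    by_cases h : (pos n (a + j)).AtLoop
    · exact Place.step_direct_of_atLoop h d
    · obtain ⟨C, hC'⟩ := (not_atLoop_pos_iff hn _).1 h
      rw [hC', step_pos_lift_direct hn]
      refine hC C (by omega) ?_
      rw [← lift_lt_lift_iff (n := n)]
      omega
  refine ⟨⟨_, hex, fun v hv => by rw [length_walk]; exact hbound v hv⟩, fun v hv => ?_⟩
  obtain ⟨⟨h1, h2⟩, h3⟩ := (hQ v).1 hv.1
  refine ⟨h1, h3, ?_⟩
  have h4 := hv.2 _ hex
  have h5 := hbound v hv.1
  rw [length_walk] at h4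
  rw [hm]
  omega

theorem walks_longest_inv_of_finish (hn : 0 < n) {Q : Word n (Letter n) → Prop} {d : Bool}
    {a B : ℤ} (hQ : ∀ v, Q v ↔ (IsString ω v ∧ IsPure d v) ∧ v.finish ω = (pos n a).flip)
    (haB : a ≤ lift n B) (hB : isDirectStep ω B = d)
    (hC : ∀ C, a ≤ lift n C → C < B → isDirectStep ω C = !d) :
    (∃ v, IsLongest Q v) ∧ ∀ v, IsLongest Q v → Walks ω v.inv a (lift n B) := by
  have hQ' : ∀ v, Q v.inv ↔ (IsString ω v ∧ IsPure (!d) v) ∧ v.start ω = pos n a := by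
    intro v
    rw [hQ]
    constructor
    · rintro ⟨⟨h1, h2⟩, h3⟩
      have h4 := h1.inv hn
      rw [Word.inv_inv] at h4
      refine ⟨⟨h4, ?_⟩, ?_⟩
      · have := h2.inv
        rwa [Word.inv_inv] at this
      · rwa [h4.finish_inv hn, Place.flip_inj] at h3
    · rintro ⟨⟨h1, h2⟩, h3⟩
      refine ⟨⟨h1.inv hn, ?_⟩, ?_⟩
      · have := h2.inv
        rwa [Bool.not_not] at this
      · rw [h1.finish_inv hn, h3]
  have hL : ∀ v, IsLongest (fun v => Q v.inv) v.inv ↔ IsLongest Q v := by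
    intro v
    simp only [IsLongest, Word.inv_inv, Word.length_inv]
    refine and_congr_right fun _ => ⟨fun h u hu => ?_, fun h u hu => ?_⟩
    · simpa using h u.inv (by simpa using hu)
    · simpa using h u.inv hu
  obtain ⟨⟨v, hv⟩, h2⟩ := walks_longest_of_start hn hQ' haB (by simpa using hB) hC
  exact ⟨⟨v.inv, (hL _).1 (by simpa using hv)⟩, fun v hv => h2 _ ((hL v).2 hv)⟩

/-! ### Hooks, cohooks and the basic strings as walks -/

theorem isString_singleton (a : Letter n) : IsString ω (.letters [a]) := by
  simp [IsString]

/-- The simple regular string `r_k` (`t = true`), or the string `r'_k` (`t = false`). -/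
noncomputable def runString (ω : Fin n → Bool) (t : Bool) (k : Fin n) : Word n (Letter n) :=
  longest fun v => (IsString ω v ∧ IsPure (!t) v) ∧ Composable ω (.letters [⟨.eta k, t⟩]) v

theorem exists_spans_runString (hn : 0 < n) {k : Fin n} {A : ℤ}
    (h : Letter.src ω ⟨.eta k, t⟩ = pos n (lift n (A - 1))) :
    ∃ B, Spans ω (runString ω t k) A B ∧ isDirectStep ω B = t ∧
      stepCount ω t B = stepCount ω t A := by
  obtain ⟨B, h1, h2, h3, h4⟩ := exists_next_step hn ω t A
  have h5 : ∀ C, lift n (A - 1) + 1 ≤ lift n C ↔ A ≤ C := by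
    intro C
    rw [Int.add_one_le_iff, lift_lt_lift_iff]
    omega
  obtain ⟨h6, h7⟩ := walks_longest_of_start (ω := ω) hn
    (Q := fun v => (IsString ω v ∧ IsPure (!t) v) ∧ Composable ω (.letters [⟨.eta k, t⟩]) v)
    (d := !t) (a := lift n (A - 1) + 1) (B := B) (fun v => by
      refine and_congr_right fun hv => ?_
      rw [composable_iff hn (isString_singleton _) hv.1, ← next_pos, ← h,
        ← Letter.tgt_eq_next hn, eq_comm]
      rfl) ((h5 B).2 h1) (by simpa using h2) (fun C hC => h3 C ((h5 C).1 hC))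
  exact ⟨B, h7 _ (Classical.epsilon_spec h6), h2, h4⟩

open Classical in
/-- The string `w[1]` (`t = true`), or the string `w[-1]` (`t = false`). -/
noncomputable def extendR (ω : Fin n → Bool) (t : Bool) (w : Word n (Letter n)) :
    Word n (Letter n) :=
  if h : ∃ k, Composable ω w (.letters [⟨.eta k, t⟩]) then
    (w.mul (.letters [⟨.eta h.choose, t⟩])).mul (runString ω t h.choose)
  else w

/-- The hook uses up the step of type `t` at `B` and then runs through steps of the other type until
the next step of type `t` is due. -/
theorem Spans.extendR (hn : 0 < n) {w : Word n (Letter n)} {A B : ℤ} (hw : Spans ω w A B)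
    (hB : isDirectStep ω B = t) :
    ∃ B', Spans ω (extendR ω t w) A B' ∧ isDirectStep ω B' = t ∧
      stepCount ω t B' = stepCount ω t B + 1 := by
  have hcomp : ∀ k, Composable ω w (.letters [⟨.eta k, t⟩]) ↔
      Letter.src ω ⟨.eta k, t⟩ = pos n (lift n B) := by
    intro k
    rw [composable_iff hn hw.isString (isString_singleton _), hw.finish hn, eq_comm]
    rfl
  have hex : ∃ k, Composable ω w (.letters [⟨.eta k, t⟩]) := by
    obtain ⟨k, hk⟩ := exists_eta_src hn ω B
    rw [hB] at hk
    exact ⟨k, (hcomp k).2 hk⟩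
  have hk := (hcomp _).1 hex.choose_spec
  obtain ⟨B', h1, h2, h3⟩ := exists_spans_runString (A := B + 1) hn (by
    rw [add_sub_cancel_right]; exact hk)
  refine ⟨B', ?_, h2, ?_⟩
  · rw [CTilde.extendR, dif_pos hex]
    rw [Spans, add_sub_cancel_right] at h1
    refine Walks.mul hn (Walks.mul hn hw ⟨isString_singleton _, hk, ?_⟩) h1
    simp [Word.length]
  · rw [h3, stepCount_succ, if_pos hB]

theorem Spans.iterate_extendR (hn : 0 < n) {w : Word n (Letter n)} {A B : ℤ}
    (hw : Spans ω w A B) (hB : isDirectStep ω B = t) (k : ℕ) :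
    ∃ B', Spans ω ((CTilde.extendR ω t)^[k] w) A B' ∧ isDirectStep ω B' = t ∧
      stepCount ω t B' = stepCount ω t B + k := by
  induction k with
  | zero => exact ⟨B, hw, hB, by simp⟩
  | succ k ih =>
    obtain ⟨B', h1, h2, h3⟩ := ih
    obtain ⟨B'', h4, h5, h6⟩ := h1.extendR hn h2
    rw [Function.iterate_succ_apply']
    exact ⟨B'', h4, h5, by push_cast; linarith⟩

/-- The string `[1]w` (`t = true`), or the string `[-1]w` (`t = false`). -/
noncomputable def extendL (ω : Fin n → Bool) (t : Bool) (w : Word n (Letter n)) :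
    Word n (Letter n) := (extendR ω t w.inv).inv

theorem iterate_extendL (k : ℕ) (w : Word n (Letter n)) :
    (extendL ω t)^[k] w = ((extendR ω t)^[k] w.inv).inv := by
  induction k with
  | zero => simp
  | succ k ih => rw [Function.iterate_succ_apply', Function.iterate_succ_apply', ih, extendL,
      Word.inv_inv]

/-- The projective string `p_i` (`t = true`), or the injective string `q_i` (`t = false`). -/
noncomputable def centralString (ω : Fin n → Bool) (t : Bool) (i : Fin (n + 1)) :
    Word n (Letter n) :=
  (longest fun v => (IsString ω v ∧ IsPure t v) ∧ Composable ω v (.triv i true)).mul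
    (longest fun v => (IsString ω v ∧ IsPure (!t) v) ∧ Composable ω (.triv i true) v)

/-- The unit `𝟙ᵢ` sits at position `i` of the cover. The right half runs from there to the first
step of type `t`; the left half, inverted, does the same from `-1 - i`. -/
theorem exists_spans_centralString (hn : 0 < n) (i : Fin (n + 1)) :
    ∃ A B, Spans ω (centralString ω t i) A B ∧ isDirectStep ω B = t ∧
      stepCount ω t B = stepCount ω t i ∧ isDirectStep ω (-A) = t ∧
      stepCount ω t (-A) = stepCount ω t (-i) := by
  have hi := i.isLt
  obtain ⟨B, h1, h2, h3, h4⟩ := exists_next_step hn ω t i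
  obtain ⟨A, h1', h2', h3', h4'⟩ := exists_next_step hn ω t (-i)
  -- For `i = n` the position `i` is a loop place, not a value of `lift`; the comparison survives
  -- because `lift` jumps from `n - 1` to `n + 1`.
  have hl1 : ∀ C : ℤ, (i : ℤ) ≤ lift n C ↔ (i : ℤ) ≤ C := by
    intro C
    constructor
    · intro h
      by_contra! hC
      have h5 := (lift_le_lift_iff (n := n)).2 (show C ≤ i - 1 by omega)
      have h7 : lift n (i - 1) ≤ i - 1 := by
        unfold lift
        have : ((i : ℤ) - 1) / n ≤ 0 := by
          have := Int.ediv_lt_of_lt_mul (a := (i : ℤ) - 1) (b := 1) (c := n) (by omega) (by omega)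
          omega
        omega
      omega
    · intro h
      refine le_trans ?_ ((lift_le_lift_iff (n := n)).2 h)
      have : 0 ≤ (i : ℤ) / n := Int.ediv_nonneg (by omega) (by omega)
      unfold lift
      omega
  have hl2 : ∀ C : ℤ, (-1 - i : ℤ) ≤ lift n C ↔ (-i : ℤ) ≤ C := by
    intro C
    have h5 : lift n C = -2 - lift n (-C - 1) := by rw [← lift_neg hn, neg_neg]
    have h6 := hl1 (-C - 1)
    rw [h5]
    omega
  obtain ⟨h6, h7⟩ := walks_longest_of_start (ω := ω) hn
    (Q := fun v => (IsString ω v ∧ IsPure (!t) v) ∧ Composable ω (.triv i true) v)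
    (d := !t) (a := i) (B := B) (fun v => by
      refine and_congr_right fun hv => ?_
      rw [composable_iff hn (by trivial) hv.1, eq_comm, pos_of_fin]
      rfl) ((hl1 B).2 h1) (by simpa using h2) (fun C hC => h3 C ((hl1 C).1 hC))
  obtain ⟨h6', h7'⟩ := walks_longest_inv_of_finish (ω := ω) hn
    (Q := fun v => (IsString ω v ∧ IsPure t v) ∧ Composable ω v (.triv i true))
    (d := t) (a := -1 - i) (B := A) (fun v => by
      refine and_congr_right fun hv => ?_
      rw [composable_iff hn hv.1 (by trivial), flip_pos, sub_sub_cancel, pos_of_fin]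
      rfl) ((hl2 A).2 h1') h2' (fun C hC => h3' C ((hl2 C).1 hC))
  refine ⟨-A, B, ?_, h2, h4, by rwa [neg_neg], by rwa [neg_neg]⟩
  have h8 := (h7' _ (Classical.epsilon_spec h6')).inv hn
  rw [Word.inv_inv, sub_sub_cancel] at h8
  have h9 := h8.mul hn (h7 _ (Classical.epsilon_spec h6))
  have h10 : lift n (-A - 1) + 1 = -1 - lift n A := by
    rw [show -A - 1 = -(A + 1) by ring, lift_neg hn, add_sub_cancel_right]; ring
  rw [Spans, h10]
  exact h9

/-- The string `[k] p_i [k]` (`t = true`), or the string `[-k] q_i [-k]` (`t = false`). -/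
noncomputable def extendedString (ω : Fin n → Bool) (t : Bool) (i : Fin (n + 1)) (k : ℕ) :
    Word n (Letter n) := (extendL ω t)^[k] ((extendR ω t)^[k] (centralString ω t i))

theorem exists_spans_extendedString (hn : 0 < n) (ω : Fin n → Bool) (t : Bool) (i : Fin (n + 1))
    (k : ℕ) :
    ∃ A B, Spans ω (extendedString ω t i k) A B ∧ isDirectStep ω B = t ∧
      stepCount ω t B = stepCount ω t i + k ∧ isDirectStep ω (-A) = t ∧
      stepCount ω t (-A) = stepCount ω t (-i) + k := by
  obtain ⟨A, B, h1, h2, h3, h4, h5⟩ := exists_spans_centralString (ω := ω) (t := t) hn i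
  obtain ⟨B', h6, h7, h8⟩ := h1.iterate_extendR hn h2 k
  -- Extending on the left is extending the inverse, whose end is `-A`, on the right.
  obtain ⟨A', h9, h10, h11⟩ := (h6.inv hn).iterate_extendR hn h4 k
  refine ⟨-A', B', ?_, h7, by rw [h8, h3], by rwa [neg_neg], by rw [neg_neg, h11, h5]⟩
  have := h9.inv hn
  rwa [← iterate_extendL, neg_neg] at this

/-! ### The defect of a rank vector -/

/-- Some arrow `η_k` goes from `i` to `j`. -/
def HasArrow (ω : Fin n → Bool) (i j : Fin (n + 1)) : Prop :=
  ∃ k : Fin n, j = (Arrow.eta k).t ω ∧ i = (Arrow.eta k).s ω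

/-- A letter is read from its terminal to its starting point, so the walk follows the arrow exactly
at inverse letters. -/
theorem hasArrow_t_s_iff (k : Fin n) (d : Bool) :
    HasArrow ω (Letter.t ω ⟨.eta k, d⟩) (Letter.s ω ⟨.eta k, d⟩) ↔ d = false := by
  cases d
  · simp only [iff_true]
    exact ⟨k, by simp [Letter.s], by simp [Letter.t]⟩
  · simp only [Bool.true_eq_false, iff_false]
    rintro ⟨j, h1, h2⟩
    simp only [Letter.s, Letter.t, if_true, Arrow.s, Arrow.t, Fin.ext_iff] at h1 h2
    have hjk : j = k := by
      rw [Fin.ext_iff]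
      cases h : ω k <;> cases h' : ω j <;> simp [h, h'] at h1 h2 <;> omega
    subst hjk
    cases h : ω j <;> simp [h] at h1 h2

theorem HasArrow.adjacent {i j : Fin (n + 1)} (h : HasArrow ω i j) :
    (i.val : ℤ) + 1 = j.val ∨ (j.val : ℤ) + 1 = i.val := by
  obtain ⟨k, rfl, rfl⟩ := h
  cases h : ω k <;> simp [Arrow.s, Arrow.t, h]

theorem hasArrow_fold_add_one_iff (hn : 0 < n) (p : ℤ) :
    HasArrow ω (fold n p) (fold n (p + 1)) ↔ isDirectStep ω p = false := by
  obtain ⟨k, hk⟩ := exists_eta_src hn ω p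
  have h1 : Letter.t ω ⟨.eta k, isDirectStep ω p⟩ = fold n p := by
    rw [← Letter.src_fst, hk, pos_lift_fst hn]
  have h2 : Letter.s ω ⟨.eta k, isDirectStep ω p⟩ = fold n (p + 1) := by
    rw [← Letter.tgt_fst, Letter.tgt_eq_next hn, hk, next_pos, pos_lift_add_one_fst hn]
  rw [← h1, ← h2, hasArrow_t_s_iff]

theorem hasArrow_fold_sub_one_iff (hn : 0 < n) (p : ℤ) :
    HasArrow ω (fold n p) (fold n (p - 1)) ↔ isDirectStep ω (p - 1) = true := by
  have h := hasArrow_fold_add_one_iff (ω := ω) hn (-p)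
  rw [fold_neg, show -p + 1 = -(p - 1) by ring, fold_neg, show -p = -1 - (p - 1) by ring,
    isDirectStep_neg hn] at h
  rw [h]
  simp

open Classical in
-- The small entries of `ρ` at the ends compensate the large entries of the form. For `2 ≤ n` no
-- arrow joins two end vertices.
theorem formMatrix_mul_rho (hn : 2 ≤ n) (i j : Fin (n + 1)) :
    formMatrix ω i j * rho n j =
      (if i = j then 2 else 0) - 2 * (symmetrizer n i * if HasArrow ω i j then 1 else 0) := by
  by_cases hij : i = j
  · subst hij
    have h : ¬ HasArrow ω i i := fun h => by have := h.adjacent; omega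
    by_cases hi : IsEnd i <;> simp [formMatrix, rho, hi, h]
  · by_cases h : HasArrow ω i j
    · have h' : formMatrix ω i j = if IsEnd i ∨ IsEnd j then -2 else -1 := by
        rw [formMatrix, if_neg hij]; exact if_pos h
      have h2 := h.adjacent
      have h3 : ¬ (IsEnd i ∧ IsEnd j) := by
        rw [isEnd_iff_int, isEnd_iff_int]; omega
      rw [h', rho, symmetrizer, if_neg hij, if_pos h]
      split_ifs <;> simp_all
    · have h' : formMatrix ω i j = 0 := by
        rw [formMatrix, if_neg hij]; exact if_neg h
      simp [h', hij, h]

open Classical in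
theorem symmetrizer_mul_sum_hasArrow (hn : 2 ≤ n) (p : ℤ) :
    symmetrizer n (fold n p) * ∑ j, (if HasArrow ω (fold n p) j then (1 : ℤ) else 0) =
      (if HasArrow ω (fold n p) (fold n (p + 1)) then 1 else 0) +
        if HasArrow ω (fold n p) (fold n (p - 1)) then 1 else 0 := by
  have hnb := fold_neighbours (n := n) (by omega) p
  simp only at hnb
  have hsub : ∀ j, HasArrow ω (fold n p) j → j = fold n (p + 1) ∨ j = fold n (p - 1) := by
    intro j hj
    have := hj.adjacent
    have := j.isLt
    rw [Fin.ext_iff, Fin.ext_iff]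
    omega
  have hsum : ∑ j, (if HasArrow ω (fold n p) j then (1 : ℤ) else 0) =
      ∑ j ∈ {fold n (p + 1), fold n (p - 1)}, if HasArrow ω (fold n p) j then (1 : ℤ) else 0 := by
    refine (Finset.sum_subset (Finset.subset_univ _) fun j _ hj => if_neg fun h => hj ?_).symm
    simpa using hsub j h
  rw [hsum]
  by_cases heq : fold n (p + 1) = fold n (p - 1)
  · have hend : IsEnd (fold n p) := by
      rw [isEnd_iff_int]
      rw [Fin.ext_iff] at heq
      omega
    rw [heq, Finset.pair_eq_singleton, Finset.sum_singleton, symmetrizer, if_pos hend]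
    ring
  · have hend : ¬ IsEnd (fold n p) := by
      rw [isEnd_iff_int]
      rw [Fin.ext_iff] at heq
      omega
    rw [Finset.sum_pair heq, symmetrizer, if_neg hend, one_mul]

/-- The defect of the simple root at `fold n p` is `2` minus `2` for each arrow leaving it along the
walk, which is the change of `2 * [step is direct]` from step `p - 1` to step `p`. -/
theorem defect_rootBetween (hn : 2 ≤ n) (A C : ℤ) :
    defect ω (rootBetween n A C) =
      (if isDirectStep ω (C - 1) = true then 2 else 0) -
        if isDirectStep ω (A - 1) = true then 2 else 0 := by
  classical
  refine map_rootBetween (defectHom ω)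
    (H := fun p => if isDirectStep ω (p - 1) = true then 2 else 0) (fun p => ?_) A C
  have h1 : defectHom ω (simpleRoot (fold n p)) =
      ∑ j, formMatrix ω (fold n p) j * rho n j := by
    change defect ω _ = _
    simp [defect, simpleRoot, Pi.single_apply]
  rw [h1]
  simp only [formMatrix_mul_rho hn, Finset.sum_sub_distrib, ← Finset.mul_sum]
  rw [symmetrizer_mul_sum_hasArrow hn, if_congr (hasArrow_fold_add_one_iff (by omega) p) rfl rfl,
    if_congr (hasArrow_fold_sub_one_iff (by omega) p) rfl rfl]
  simp only [Finset.sum_ite_eq, Finset.mem_univ, if_true, add_sub_cancel_right]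
  cases isDirectStep ω p <;> cases isDirectStep ω (p - 1) <;> simp

/-- Rewritten with the exit steps `B` and `-A` of the string and its inverse, on which hooks act. -/
theorem defect_rootBetween_succ (hn : 2 ≤ n) (A B : ℤ) :
    defect ω (rootBetween n A (B + 1)) =
      (if isDirectStep ω B = true then 2 else 0) -
        if isDirectStep ω (-A) = false then 2 else 0 := by
  have h := isDirectStep_neg (ω := ω) (by omega : 0 < n) (A - 1)
  rw [show -1 - (A - 1) = -A by ring] at h
  rw [defect_rootBetween hn, h, add_sub_cancel_right]
  simp

/-! ### Classification of the walks of preprojective, preinjective and regular strings -/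

theorem Spans.unique (hn : 0 < n) {w : Word n (Letter n)} {A B A' B' : ℤ}
    (h : Spans ω w A B) (h' : Spans ω w A' B') :
    ∃ q, A' = A + 2 * n * q ∧ B' = B + 2 * n * q :=
  (h.toStar_eq_iff hn h').1 rfl

/-- Translating by `2 * n * q` changes the two counts by `n * q` and `-n * q`: the sum is invariant,
the difference only modulo `2 * n`. -/
theorem Spans.extendedString_invariants (hn : 0 < n) {i : Fin (n + 1)} {k : ℕ} {A B : ℤ}
    (h : Spans ω (extendedString ω t i k) A B) :
    isDirectStep ω B = t ∧ isDirectStep ω (-A) = t ∧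
      stepCount ω t B + stepCount ω t (-A) = stepCount ω t i + stepCount ω t (-i) + 2 * k ∧
      ∃ q, stepCount ω t B - stepCount ω t (-A) = i + 2 * n * q := by
  obtain ⟨A', B', h1, h2, h3, h4, h5⟩ := exists_spans_extendedString hn ω t i k
  obtain ⟨q, rfl, rfl⟩ := h1.unique hn h
  have h6 : -(A' + 2 * n * q) = -A' + 2 * n * (-q) := by ring
  rw [h6, isDirectStep_add_mul hn, isDirectStep_add_mul hn, stepCount_add_mul hn,
    stepCount_add_mul hn, h3, h5]
  refine ⟨h2, h4, by ring, q, ?_⟩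
  have := stepCount_sub_neg (ω := ω) (t := t) hn i
  linear_combination this

theorem extendedString_unique (hn : 0 < n) {i j : Fin (n + 1)} {k l : ℕ} {A B : ℤ}
    (h : Spans ω (extendedString ω t i k) A B)
    (h' : Spans ω (extendedString ω t j l) A B ∨ Spans ω (extendedString ω t j l) (-B) (-A)) :
    i = j ∧ k = l := by
  obtain ⟨-, -, h1, q, h2⟩ := h.extendedString_invariants hn
  have h3 : stepCount ω t B + stepCount ω t (-A) =
        stepCount ω t j + stepCount ω t (-j) + 2 * l ∧
      ∃ q, stepCount ω t B - stepCount ω t (-A) = j + 2 * n * q ∨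
        stepCount ω t B - stepCount ω t (-A) = -(j + 2 * n * q) := by
    rcases h' with h' | h'
    · obtain ⟨-, -, h3, q, h4⟩ := h'.extendedString_invariants hn
      exact ⟨h3, q, Or.inl h4⟩
    · obtain ⟨-, -, h3, q, h4⟩ := h'.extendedString_invariants hn
      rw [neg_neg] at h3 h4
      exact ⟨by rw [add_comm]; exact h3, q, Or.inr (by rw [← h4]; ring)⟩
  obtain ⟨h3, r, h4⟩ := h3
  -- Inversion changes the sign of the difference, and `fold` separates residues modulo `2 * n` up
  -- to sign.
  have hij : i = j := by
    rw [← fold_coe i, ← fold_coe j, fold_eq_fold_iff hn]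
    rcases h4 with h4 | h4
    · exact Or.inl ⟨r - q, by linear_combination h4 - h2⟩
    · exact Or.inr ⟨-r - q, by linear_combination h4 - h2⟩
  subst hij
  exact ⟨rfl, by omega⟩

theorem exists_extendedString (hn : 0 < n) {A B : ℤ} (hAB : A ≤ B) (hB : isDirectStep ω B = t)
    (hA : isDirectStep ω (-A) = t) :
    ∃ i k, Spans ω (extendedString ω t i k) A B ∨ Spans ω (extendedString ω t i k) (-B) (-A) := by
  have key : ∀ (i : Fin (n + 1)) (A B q : ℤ), A ≤ B → isDirectStep ω B = t →
      isDirectStep ω (-A) = t → stepCount ω t B - stepCount ω t (-A) = 2 * n * q + i →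
      ∃ k, Spans ω (extendedString ω t i k) A B := by
    intro i A B q hAB hB hA h
    have hs := stepCount_sub_neg (ω := ω) (t := t) hn i
    have hB' := hB
    have hA' := hA
    rw [← isDirectStep_add_mul hn _ (-q)] at hB'
    rw [← isDirectStep_add_mul hn _ q] at hA'
    have h1 := stepCount_add_mul (ω := ω) (t := t) hn B (-q)
    have h2 := stepCount_add_mul (ω := ω) (t := t) hn (-A) q
    -- This will be the number of hooks. It equals the corresponding quantity for `-A`; if it were
    -- negative, both ends would fall short of `i` and `-i`, against `A ≤ B`.
    have hk : 0 ≤ stepCount ω t B - n * q - stepCount ω t i := by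
      by_contra! hlt
      have h3 : B + 2 * n * (-q) < i := by
        by_contra! h3
        have := stepCount_mono (ω := ω) (t := t) h3
        rw [h1] at this
        linarith
      have h4 : -A + 2 * n * q < -i := by
        by_contra! h4
        have := stepCount_mono (ω := ω) (t := t) h4
        rw [h2] at this
        linarith
      linarith
    obtain ⟨k, hk⟩ := Int.eq_ofNat_of_zero_le hk
    refine ⟨k, ?_⟩
    obtain ⟨A', B', h3, h4, h5, h6, h7⟩ := exists_spans_extendedString hn ω t i k
    have hBB : B' = B + 2 * n * (-q) := stepCount_inj h4 hB' (by rw [h5, h1]; linarith)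
    have hAA : -A' = -A + 2 * n * q := stepCount_inj h6 hA' (by rw [h7, h2]; linarith)
    have h8 := h3.translate hn q
    rwa [hBB, show A' + 2 * n * q = A by linear_combination -hAA,
      show B + 2 * n * (-q) + 2 * n * q = B by ring] at h8
  obtain ⟨q, r, hqr, h0, h1⟩ :=
    exists_two_mul_add hn (stepCount ω t B - stepCount ω t (-A))
  -- A negative residue becomes a vertex after passing to the inverse string.
  by_cases hr : 0 ≤ r
  · obtain ⟨k, hk⟩ := key ⟨r.toNat, by omega⟩ A B q hAB hB hA (by
      rw [hqr]; simp only; omega)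
    exact ⟨_, k, Or.inl hk⟩
  · obtain ⟨k, hk⟩ := key ⟨(-r).toNat, by omega⟩ (-B) (-A) (-q) (by omega) hA
      (by rwa [neg_neg]) (by
        have : (((-r).toNat : ℕ) : ℤ) = -r := by omega
        rw [neg_neg]
        simp only [this]
        linear_combination -hqr)
    exact ⟨_, k, Or.inr hk⟩

theorem exists_spans_regularString (hn : 0 < n) (ω : Fin n → Bool) (i : Fin n) (k : ℕ) :
    ∃ A B, Spans ω (regularString ω i k) A B ∧ isDirectStep ω B = true ∧
      Letter.src ω ⟨.eta i, true⟩ = pos n (lift n (A - 1)) ∧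
      stepCount ω true B = stepCount ω true A + k := by
  obtain ⟨p, hp⟩ := exists_pos_eq (Letter.src ω ⟨.eta i, true⟩)
  have h0 : ¬ (Letter.src ω ⟨.eta i, true⟩).AtLoop := by
    have := i.isLt
    cases h : ω i <;> simp [Letter.src, Place.AtLoop, Letter.t, Arrow.t, h, Fin.ext_iff]
    omega
  rw [← hp, not_atLoop_pos_iff hn] at h0
  obtain ⟨A, rfl⟩ := h0
  have hsrc : Letter.src ω ⟨.eta i, true⟩ = pos n (lift n (A + 1 - 1)) := by
    rw [← hp, add_sub_cancel_right]
  obtain ⟨B, h1, h2, h3⟩ := exists_spans_runString hn hsrc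
  obtain ⟨B', h4, h5, h6⟩ := h1.iterate_extendR hn h2 k
  exact ⟨A + 1, B', h4, h5, hsrc, by rw [h6, h3]⟩

theorem Spans.regularString_invariants (hn : 0 < n) {i : Fin n} {k : ℕ} {A B : ℤ}
    (h : Spans ω (regularString ω i k) A B) :
    isDirectStep ω B = true ∧ isDirectStep ω (-A) = false ∧
      Letter.src ω ⟨.eta i, true⟩ = pos n (lift n (A - 1)) ∧
      stepCount ω true B = stepCount ω true A + k := by
  obtain ⟨A', B', h1, h2, h3, h4⟩ := exists_spans_regularString hn ω i k
  obtain ⟨q, rfl, rfl⟩ := h1.unique hn h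
  have hdir := Letter.direct_eq_isDirectStep hn _ h3
  refine ⟨by rw [isDirectStep_add_mul hn, h2], ?_, ?_, ?_⟩
  · rw [show -(A' + 2 * n * q) = -1 - (A' - 1) + 2 * n * (-q) by ring, isDirectStep_add_mul hn,
      isDirectStep_neg hn, ← hdir]
    rfl
  · rw [h3, show A' + 2 * n * q - 1 = A' - 1 + 2 * n * q by ring, lift_add_mul hn,
      pos_eq_pos_iff]
    exact ⟨-q, by ring⟩
  · rw [stepCount_add_mul hn, stepCount_add_mul hn, h4]
    ring

/-- The step entering the walk is the letter `ηᵢ`, and the number of direct steps from `A` to `B` is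
`k`. -/
theorem regularString_unique (hn : 0 < n) {i j : Fin n} {k l : ℕ} {A B : ℤ}
    (h : Spans ω (regularString ω i k) A B) (h' : Spans ω (regularString ω j l) A B) :
    i = j ∧ k = l := by
  obtain ⟨-, -, h1, h2⟩ := h.regularString_invariants hn
  obtain ⟨-, -, h3, h4⟩ := h'.regularString_invariants hn
  have h5 := (Letter.toStar_eq_iff hn _ _).2 (h1.trans h3.symm)
  simp only [Letter.toStar, StarLetter.eta.injEq, and_true] at h5
  exact ⟨h5, by omega⟩

theorem exists_regularString (hn : 0 < n) {A B : ℤ} (hAB : A ≤ B)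
    (hB : isDirectStep ω B = true) (hA : isDirectStep ω (-A) = false) :
    ∃ i k, Spans ω (regularString ω i k) A B := by
  have hA' := isDirectStep_neg (ω := ω) hn (A - 1)
  rw [show -1 - (A - 1) = -A by ring, hA] at hA'
  obtain ⟨i, hi⟩ := exists_eta_src hn ω (A - 1)
  rw [show isDirectStep ω (A - 1) = true by simpa using hA'] at hi
  obtain ⟨k, hk⟩ := Int.eq_ofNat_of_zero_le
    (sub_nonneg.2 (stepCount_mono (ω := ω) (t := true) hAB))
  obtain ⟨B', h1, h2, h3⟩ := exists_spans_runString hn hi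
  obtain ⟨B'', h4, h5, h6⟩ := h1.iterate_extendR hn h2 k
  have : B'' = B := stepCount_inj h5 hB (by rw [h6, h3, ← hk]; ring)
  subst this
  exact ⟨i, k, h4⟩

/-! ### Rank fibres and similarity classes -/

/-- By `rootBetween_injective`, equal rank means the same walk up to translation, which stays in a
similarity class, and inversion. -/
theorem Spans.rkFiber_eq (hn : 0 < n) {w : Word n (Letter n)} {A B : ℤ}
    (hAB : ¬ (2 * n : ℤ) ∣ B + 1 - A) (h : Spans ω w A B ∨ Spans ω w (-B) (-A)) :
    rkFiber ω (rootBetween n A (B + 1)) = simClassPM ω w := by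
  have key : ∀ {A B : ℤ}, ¬ (2 * n : ℤ) ∣ B + 1 - A → Spans ω w A B →
      rkFiber ω (rootBetween n A (B + 1)) = simClassPM ω w := by
    intro A B hAB h
    have hinv := h.inv hn
    ext v
    simp only [rkFiber, simClassPM, Set.mem_ofPred_eq, Set.mem_union, h.simClass_eq hn,
      hinv.simClass_eq hn]
    constructor
    · rintro ⟨hv, hrk⟩
      obtain ⟨A', B', hv⟩ := exists_spans hn hv
      rw [hv.rk_eq hn] at hrk
      rcases rootBetween_injective hn hAB hrk.symm with ⟨q, rfl, h2⟩ | ⟨q, rfl, h2⟩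
      · left
        have := hv.translate hn (-q)
        rwa [show A + 2 * n * q + 2 * n * (-q) = A by ring,
          show B' + 2 * n * (-q) = B by linear_combination h2] at this
      · right
        have := hv.translate hn (-q)
        rwa [show 1 - (B + 1) + 2 * n * q + 2 * n * (-q) = -B by ring,
          show B' + 2 * n * (-q) = -A by linear_combination h2] at this
    · rintro (hv | hv)
      · exact ⟨hv.mem_lfStrings hn, hv.rk_eq hn⟩
      · refine ⟨hv.mem_lfStrings hn, ?_⟩
        rw [hv.rk_eq hn, ← rootBetween_reflect]
        congr 1 <;> ring
  rcases h with h | h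
  · exact key hAB h
  · have := key (by rwa [show -A + 1 - -B = B + 1 - A by ring]) h
    rw [← this, ← rootBetween_reflect]
    congr 1; ring

theorem mem_simClassPM_self {w : Word n (Letter n)} (h : IsString ω w) : w ∈ simClassPM ω w :=
  Or.inl ⟨h, rfl⟩

theorem Spans.of_mem_simClassPM (hn : 0 < n) {v w : Word n (Letter n)} {A B : ℤ}
    (hw : Spans ω w A B) (h : v ∈ simClassPM ω w) : Spans ω v A B ∨ Spans ω v (-B) (-A) := by
  rwa [simClassPM, hw.simClass_eq hn, (hw.inv hn).simClass_eq hn] at h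

/-- Similarity to the inverse means that `(-B, -A)` is a translate of `(A, B)`. -/
theorem Spans.simClass_eq_simClass_inv_iff (hn : 0 < n) {w : Word n (Letter n)} {A B : ℤ}
    (h : Spans ω w A B) :
    simClass ω w = simClass ω w.inv ↔ (2 * n : ℤ) ∣ A + B := by
  have h1 : simClass ω w = simClass ω w.inv ↔ w.toStar = w.inv.toStar := by
    constructor
    · intro h2
      have h3 : w ∈ simClass ω w := ⟨h.isString, rfl⟩
      rw [h2] at h3
      exact h3.2
    · intro h2
      simp only [simClass, h2]
  rw [h1, h.toStar_eq_iff hn (h.inv hn)]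
  constructor
  · rintro ⟨q, h2, -⟩
    exact ⟨-q, by linear_combination -h2⟩
  · rintro ⟨q, hq⟩
    exact ⟨-q, by linear_combination -hq, by linear_combination -hq⟩

theorem rkFiber_eq_extendedString (hn : 0 < n) {A B : ℤ} (hAB : A ≤ B)
    (hd : ¬ (2 * n : ℤ) ∣ B + 1 - A) (hreal : IsRealRoot (rootBetween n A (B + 1)))
    (hB : isDirectStep ω B = t) (hA : isDirectStep ω (-A) = t) :
    (∃! x : Fin (n + 1) × ℕ, rkFiber ω (rootBetween n A (B + 1)) =
        simClassPM ω (extendedString ω t x.1 x.2)) ∧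
      ∀ i k, rkFiber ω (rootBetween n A (B + 1)) = simClassPM ω (extendedString ω t i k) →
        (simClass ω (extendedString ω t i k) = simClass ω (extendedString ω t i k).inv ↔
          IsLongRoot (rootBetween n A (B + 1))) := by
  constructor
  · obtain ⟨i, k, h⟩ := exists_extendedString hn hAB hB hA
    have hfib := Spans.rkFiber_eq hn hd h
    refine ⟨(i, k), hfib, ?_⟩
    rintro ⟨j, l⟩ hjl
    simp only at hjl
    obtain ⟨A', B', h1, -⟩ := exists_spans_extendedString hn ω t j l
    have h2 := mem_simClassPM_self h1.isString
    rw [← hjl, hfib] at h2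
    have h3 : i = j ∧ k = l := by
      rcases h with h | h
      · exact extendedString_unique hn h (h.of_mem_simClassPM hn h2)
      · exact extendedString_unique hn h (h.of_mem_simClassPM hn h2)
    rw [h3.1, h3.2]
  · intro i k h
    obtain ⟨A', B', h1, -⟩ := exists_spans_extendedString hn ω t i k
    have h2 := mem_simClassPM_self h1.isString
    rw [← h] at h2
    have h3 := h2.2
    -- The root is rewritten with the endpoints of the given string, so both sides become `2 * n ∣
    -- A' + B'`.
    rw [h1.rk_eq hn] at h3
    rw [← h3] at hreal ⊢
    rw [h1.simClass_eq_simClass_inv_iff hn, isLongRoot_rootBetween_iff hn hreal,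
      show A' + (B' + 1) - 1 = A' + B' by ring]

theorem rkFiber_eq_regularString (hn : 0 < n) {A B : ℤ} (hAB : A ≤ B)
    (hd : ¬ (2 * n : ℤ) ∣ B + 1 - A) (hB : isDirectStep ω B = true)
    (hA : isDirectStep ω (-A) = false) :
    ∃! x : Fin n × ℕ, rkFiber ω (rootBetween n A (B + 1)) =
      simClassPM ω (regularString ω x.1 x.2) := by
  obtain ⟨i, k, h⟩ := exists_regularString hn hAB hB hA
  have hfib := Spans.rkFiber_eq hn hd (Or.inl h)
  refine ⟨(i, k), hfib, ?_⟩
  rintro ⟨j, l⟩ hjl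
  simp only at hjl
  obtain ⟨A', B', h1, -⟩ := exists_spans_regularString hn ω j l
  have h2 := mem_simClassPM_self h1.isString
  rw [← hjl, hfib] at h2
  rcases h.of_mem_simClassPM hn h2 with h3 | h3
  · have := regularString_unique hn h h3
    rw [this.1, this.2]
  -- Regular strings exit by a direct step, so the reversed walk, which exits by an inverse one, is
  -- excluded.
  · have := (h3.regularString_invariants hn).1
    simp [hA] at this

/-- A locally free string is similar to its inverse iff its rank vector is a long root. -/
theorem Spans.isLongRoot_rk_iff (hn : 0 < n) {w : Word n (Letter n)} {A B : ℤ}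
    (h : Spans ω w A B) :
    (rk ω w ∈ posRealRoots n ∧ IsLongRoot (rk ω w)) ↔ (2 * n : ℤ) ∣ A + B := by
  rw [h.rk_eq hn]
  have h1 : A + (B + 1) - 1 = A + B := by ring
  constructor
  · rintro ⟨h2, h3⟩
    rwa [isLongRoot_rootBetween_iff hn h2.1, h1] at h3
  · intro h2
    have h3 : IsRealRoot (rootBetween n A (B + 1)) :=
      isRealRoot_rootBetween_of_dvd hn (by have := h.le; omega) (by rwa [h1])
    exact ⟨⟨h3, rootBetween_nonneg (by have := h.le; omega)⟩,
      (isLongRoot_rootBetween_iff hn h3).2 (by rwa [h1])⟩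

/-! ### The τ-locally free strings in a similarity class -/

/-- `preprojString` and `preinjString` are definitionally `extendedString` at `true` and `false`, so
the two cases merge. -/
theorem mem_tauStrings_iff (w : Word n (Letter n)) :
    w ∈ tauStrings ω ↔ w ∈ lfStrings ω ∧
      ((∃ t i k, w = extendedString ω t i k ∨ w = (extendedString ω t i k).inv) ∨
        ∃ i k, w = regularString ω i k ∨ w = (regularString ω i k).inv) := by
  refine and_congr_right fun _ => ?_
  constructor
  · rintro (⟨i, k, h⟩ | ⟨i, k, h⟩ | ⟨i, k, h⟩)
    · exact Or.inl ⟨true, i, k, h⟩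
    · exact Or.inr ⟨i, k, h⟩
    · exact Or.inl ⟨false, i, k, h⟩
  · rintro (⟨t, i, k, h⟩ | ⟨i, k, h⟩)
    · cases t
      · exact Or.inr (Or.inr ⟨i, k, h⟩)
      · exact Or.inl ⟨i, k, h⟩
    · exact Or.inr (Or.inl ⟨i, k, h⟩)

theorem Spans.spans_inv_iff (hn : 0 < n) {w : Word n (Letter n)} {A B : ℤ} :
    Spans ω w.inv A B ↔ Spans ω w (-B) (-A) := by
  constructor
  · intro h
    have := h.inv hn
    rwa [Word.inv_inv] at this
  · intro h
    have := h.inv hn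
    rwa [neg_neg, neg_neg] at this

theorem inv_mem_tauStrings (hn : 0 < n) {w : Word n (Letter n)} (hw : w ∈ tauStrings ω) :
    w.inv ∈ tauStrings ω := by
  obtain ⟨A, B, h⟩ := exists_spans hn hw.1
  refine (mem_tauStrings_iff _).2 ⟨(h.inv hn).mem_lfStrings hn, ?_⟩
  rcases ((mem_tauStrings_iff w).1 hw).2 with ⟨t, i, k, rfl | rfl⟩ | ⟨i, k, rfl | rfl⟩
  · exact Or.inl ⟨t, i, k, Or.inr rfl⟩
  · exact Or.inl ⟨t, i, k, Or.inl (Word.inv_inv _)⟩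
  · exact Or.inr ⟨i, k, Or.inr rfl⟩
  · exact Or.inr ⟨i, k, Or.inl (Word.inv_inv _)⟩

/-- The `τ`-locally free strings which are similar to a given one, in the preprojective and in the
preinjective case. -/
theorem exists_extendedString_similar (hn : 0 < n) {A B : ℤ} (hAB : A ≤ B)
    (hB : isDirectStep ω B = t) (hA : isDirectStep ω (-A) = t) :
    ∃ w ∈ tauStrings ω, Spans ω w A B ∧
      ∀ v ∈ tauStrings ω, Spans ω v A B → v = w ∨ v = w.inv := by
  obtain ⟨i, k, h⟩ := exists_extendedString hn hAB hB hA
  have key : ∀ v ∈ tauStrings ω, Spans ω v A B →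
      v = extendedString ω t i k ∨ v = (extendedString ω t i k).inv := by
    intro v hv hvs
    rcases ((mem_tauStrings_iff v).1 hv).2 with ⟨t', j, l, hv⟩ | ⟨j, l, hv⟩
    · have h1 : Spans ω (extendedString ω t' j l) A B ∨
          Spans ω (extendedString ω t' j l) (-B) (-A) := by
        rcases hv with rfl | rfl
        · exact Or.inl hvs
        · exact Or.inr ((Spans.spans_inv_iff hn).1 hvs)
      -- The type is visible at the exit step, so preprojective and preinjective strings are never
      -- similar.
      have ht : t' = t := by
        rcases h1 with h1 | h1
        · rw [← (h1.extendedString_invariants hn).1, hB]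
        · rw [← (h1.extendedString_invariants hn).1, hA]
      subst ht
      have h2 : i = j ∧ k = l := by
        rcases h with h | h
        · exact extendedString_unique hn h h1
        · exact extendedString_unique hn h (by rwa [neg_neg, neg_neg, or_comm])
      rw [h2.1, h2.2]
      exact hv
    · rcases hv with rfl | rfl
      · obtain ⟨h1, h2, -⟩ := hvs.regularString_invariants hn
        rw [← hB, h1] at hA
        rw [hA] at h2
        exact absurd h2 (by simp)
      · obtain ⟨h1, h2, -⟩ := ((Spans.spans_inv_iff hn).1 hvs).regularString_invariants hn
        rw [neg_neg] at h2
        rw [← hB, h2, h1] at hA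
        exact absurd hA (by simp)
  rcases h with h | h
  · exact ⟨_, (mem_tauStrings_iff _).2 ⟨h.mem_lfStrings hn, Or.inl ⟨t, i, k, Or.inl rfl⟩⟩, h, key⟩
  · have h' := (Spans.spans_inv_iff hn).2 h
    refine ⟨_, (mem_tauStrings_iff _).2 ⟨h'.mem_lfStrings hn, Or.inl ⟨t, i, k, Or.inr rfl⟩⟩, h',
      fun v hv hvs => ?_⟩
    rw [Word.inv_inv, or_comm]
    exact key v hv hvs

/-- The `τ`-locally free string which is similar to a given one, in the regular case. -/
theorem exists_regularString_similar (hn : 0 < n) {A B : ℤ} (hAB : A ≤ B)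
    (hne : isDirectStep ω B ≠ isDirectStep ω (-A)) :
    ∃ w ∈ tauStrings ω, Spans ω w A B ∧ ∀ v ∈ tauStrings ω, Spans ω v A B → v = w := by
  have key : ∀ {A B : ℤ}, A ≤ B → isDirectStep ω B = true → isDirectStep ω (-A) = false →
      ∃ w ∈ tauStrings ω, Spans ω w A B ∧ ∀ v ∈ tauStrings ω, Spans ω v A B → v = w := by
    intro A B hAB hB hA
    obtain ⟨i, k, h⟩ := exists_regularString hn hAB hB hA
    refine ⟨_, (mem_tauStrings_iff _).2 ⟨h.mem_lfStrings hn, Or.inr ⟨i, k, Or.inl rfl⟩⟩, h,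
      fun v hv hvs => ?_⟩
    rcases ((mem_tauStrings_iff v).1 hv).2 with ⟨t', j, l, rfl | rfl⟩ | ⟨j, l, rfl | rfl⟩
    · obtain ⟨h1, h2, -⟩ := hvs.extendedString_invariants hn
      rw [hB] at h1
      rw [hA, ← h1] at h2
      exact absurd h2 (by simp)
    · obtain ⟨h1, h2, -⟩ := ((Spans.spans_inv_iff hn).1 hvs).extendedString_invariants hn
      rw [neg_neg, hB] at h2
      rw [hA, ← h2] at h1
      exact absurd h1 (by simp)
    · obtain ⟨rfl, rfl⟩ := regularString_unique hn h hvs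
      rfl
    · have h1 := (((Spans.spans_inv_iff hn).1 hvs).regularString_invariants hn).1
      rw [hA] at h1
      exact absurd h1 (by simp)
  cases hB : isDirectStep ω B with
  | true => exact key hAB hB (by simpa [hB] using hne.symm)
  | false =>
    have hA : isDirectStep ω (-A) = true := by simpa [hB] using hne.symm
    obtain ⟨w, h1, h2, h3⟩ := key (A := -B) (B := -A) (by omega) hA (by rwa [neg_neg])
    refine ⟨w.inv, inv_mem_tauStrings hn h1, (Spans.spans_inv_iff hn).2 h2, fun v hv hvs => ?_⟩
    rw [← h3 v.inv (inv_mem_tauStrings hn hv) (hvs.inv hn), Word.inv_inv]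

end CTilde

/-! ### The three claims -/

theorem corollary3p8 (n : ℕ) (hn : 2 ≤ n) (ω : Fin n → Bool) :
    (∀ w ∈ CTilde.lfStrings ω, ∃ w' ∈ CTilde.tauStrings ω,
      ((CTilde.rk ω w ∈ CTilde.posRealRoots n ∧ CTilde.IsLongRoot (CTilde.rk ω w)) →
        CTilde.simClass ω w ∩ CTilde.tauStrings ω = {w', w'.inv}) ∧
      (¬ (CTilde.rk ω w ∈ CTilde.posRealRoots n ∧ CTilde.IsLongRoot (CTilde.rk ω w)) →
        CTilde.simClass ω w ∩ CTilde.tauStrings ω = {w'})) ∧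
    (∀ α ∈ CTilde.posRealRoots n,
      (0 < CTilde.defect ω α →
        (∃! x : Fin (n + 1) × ℕ,
          CTilde.rkFiber ω α = CTilde.simClassPM ω (CTilde.preprojString ω x.1 x.2)) ∧
        (∀ i k, CTilde.rkFiber ω α = CTilde.simClassPM ω (CTilde.preprojString ω i k) →
          (CTilde.simClass ω (CTilde.preprojString ω i k) =
              CTilde.simClass ω (CTilde.preprojString ω i k).inv ↔
            CTilde.IsLongRoot α))) ∧
      (CTilde.defect ω α = 0 →
        ∃! x : Fin n × ℕ,
          CTilde.rkFiber ω α = CTilde.simClassPM ω (CTilde.regularString ω x.1 x.2)) ∧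
      (CTilde.defect ω α < 0 →
        (∃! x : Fin (n + 1) × ℕ,
          CTilde.rkFiber ω α = CTilde.simClassPM ω (CTilde.preinjString ω x.1 x.2)) ∧
        (∀ i k, CTilde.rkFiber ω α = CTilde.simClassPM ω (CTilde.preinjString ω i k) →
          (CTilde.simClass ω (CTilde.preinjString ω i k) =
              CTilde.simClass ω (CTilde.preinjString ω i k).inv ↔
            CTilde.IsLongRoot α)))) := by
  have hn0 : 0 < n := by omega
  constructor
  · intro w hw
    obtain ⟨A, B, h⟩ := CTilde.exists_spans hn0 hw
    rw [h.isLongRoot_rk_iff hn0, h.simClass_eq hn0]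
    -- Equal exit types are the preprojective and preinjective cases, different ones the regular
    -- case.
    by_cases heq : CTilde.isDirectStep ω B = CTilde.isDirectStep ω (-A)
    · obtain ⟨w', h1, h2, h3⟩ := CTilde.exists_extendedString_similar hn0 h.le rfl heq.symm
      have hinv : w'.inv ∈ CTilde.tauStrings ω := CTilde.inv_mem_tauStrings hn0 h1
      refine ⟨w', h1, fun hd => ?_, fun hd => ?_⟩
      -- For a long root the inverse lies in the same similarity class.
      · have h4 : CTilde.Spans ω w'.inv A B := by
          obtain ⟨q, hq⟩ := hd
          have := (h2.inv hn0).translate hn0 q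
          rwa [← hq, show -B + (A + B) = A by ring, show -A + (A + B) = B by ring] at this
        ext v
        simp only [Set.mem_inter_iff, Set.mem_ofPred_eq, Set.mem_insert_iff,
          Set.mem_singleton_iff]
        constructor
        · exact fun hv => h3 v hv.2 hv.1
        · rintro (rfl | rfl)
          · exact ⟨h2, h1⟩
          · exact ⟨h4, hinv⟩
      · ext v
        simp only [Set.mem_inter_iff, Set.mem_ofPred_eq, Set.mem_singleton_iff]
        constructor
        · rintro ⟨hv1, hv2⟩
          rcases h3 v hv2 hv1 with rfl | rfl
          · rfl
          · obtain ⟨q, hq, -⟩ := (h2.inv hn0).unique hn0 hv1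
            exact absurd ⟨q, by linear_combination hq⟩ hd
        · rintro rfl
          exact ⟨h2, h1⟩
    · obtain ⟨w', h1, h2, h3⟩ := CTilde.exists_regularString_similar hn0 h.le heq
      refine ⟨w', h1, fun hd => ?_, fun hd => ?_⟩
      -- A regular string never has a long root as rank: `2 * n ∣ A + B` would make `-A` a translate
      -- of `B`, with the same exit type.
      · obtain ⟨q, hq⟩ := hd
        refine absurd ?_ heq
        rw [show -A = B + 2 * n * (-q) by linear_combination -hq,
          CTilde.isDirectStep_add_mul hn0]
      · ext v
        simp only [Set.mem_inter_iff, Set.mem_ofPred_eq, Set.mem_singleton_iff]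
        constructor
        · exact fun hv => h3 v hv.2 hv.1
        · rintro rfl
          exact ⟨h2, h1⟩
  · rintro α ⟨hreal, hpos⟩
    obtain ⟨A, C, hd, rfl⟩ := hreal.exists_rootBetween hn0
    obtain ⟨B, rfl⟩ : ∃ B, C = B + 1 := ⟨C - 1, by ring⟩
    have hAB : A ≤ B := by
      have h1 := CTilde.le_of_rootBetween_nonneg hpos
      have h2 : A ≠ B + 1 := by
        rintro rfl
        simp at hd
      omega
    rw [CTilde.defect_rootBetween_succ hn]
    refine ⟨fun h => ?_, fun h => ?_, fun h => ?_⟩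
    · have h1 : CTilde.isDirectStep ω B = true ∧ CTilde.isDirectStep ω (-A) = true := by
        cases h1 : CTilde.isDirectStep ω B <;> cases h2 : CTilde.isDirectStep ω (-A) <;>
          simp [h1, h2] at h ⊢
      exact CTilde.rkFiber_eq_extendedString hn0 hAB hd hreal h1.1 h1.2
    · by_cases hB : CTilde.isDirectStep ω B = true
      · have hA : CTilde.isDirectStep ω (-A) = false := by
          cases h2 : CTilde.isDirectStep ω (-A) <;> simp [hB, h2] at h ⊢
        exact CTilde.rkFiber_eq_regularString hn0 hAB hd hB hA
      -- Here the reversed walk `(-B, -A)` is the regular one, and it has the same root.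
      · have hA : CTilde.isDirectStep ω (-A) = true := by
          cases h2 : CTilde.isDirectStep ω (-A) <;> simp [hB, h2] at h ⊢
        have := CTilde.rkFiber_eq_regularString (ω := ω) hn0 (A := -B) (B := -A) (by omega)
          (by rwa [show -A + 1 - -B = B + 1 - A by ring]) hA (by simpa using hB)
        rwa [← CTilde.rootBetween_reflect, show 1 - (-A + 1) = A by ring,
          show 1 - -B = B + 1 by ring] at this
    · have h1 : CTilde.isDirectStep ω B = false ∧ CTilde.isDirectStep ω (-A) = false := by
        cases h1 : CTilde.isDirectStep ω B <;> cases h2 : CTilde.isDirectStep ω (-A) <;>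
          simp [h1, h2] at h ⊢
      exact CTilde.rkFiber_eq_extendedString hn0 hAB hd hreal h1.1 h1.2
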